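/- Let $k\ge 1$, $0<\gamma\le 1$, and let $P$ be a probability measure on $\mathbb R^k$ with a Lebesgue density $f$. For $\mu\in\mathbb R^k$, $\Sigma$ a positive definite symmetric $k\times k$ matrix and $\rho\geq 0$, put $E(\mu,\Sigma,\rho)=\{x\in\mathbb R^k:(x-\mu)'\Sigma^{-1}(x-\mu)\le\rho^2\}$. For measurable $\phi:\mathbb R^k\to[0,1]$ with $\int\phi\,dP\ge\gamma$ and $\int\|x\|^2\phi(x)\,P(dx)<\infty$, let $$T_P(\phi)=\frac{1}{\int\phi\,dP}\int x\,\phi(x)\,P(dx),\qquad C_P(\phi)=\frac1{\int\phi\,dP}\int (x-T_P(\phi))(x-T_P(\phi))'\phi(x)\,P(dx),$$ $$r_P(\phi)=\inf\{s>0: P(E(T_P(\phi),C_P(\phi),s))\ge\gamma\}.$$ Suppose that the MCD functional is uniquely defined at $P$, i.e. there are minimizers $\phi_P$ of $\det C_P(\phi)$ over all such $\phi$, and all of them give the same pair $(\mu_0,\Sigma_0)=(T_P(\phi_P),C_P(\phi_P))$. Let $\rho_0=r_P(\phi_P)$, assumed finite (as it always is when $\gamma<1$), let $\Gamma_0$ be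 the symmetric positive definite matrix with $\Gamma_0^2=\Sigma_0$, and let $\theta_0=(\mu_0,\Gamma_0,\rho_0)$. Assume condition (B): $f$ is continuous and strictly positive on an open neighborhood of the boundary of $E(\mu_0,\Sigma_0,\rho_0)$. Let $S(k)$ be the space of symmetric $k\times k$ matrices and $\mathrm{PDS}(k)\subset S(k)$ the open subset of positive definite ones. For $\theta=(m,G,r)\in\mathbb R^k\times\mathrm{PDS}(k)\times\mathbb R$ and $j=1,2,3$ let $\Lambda_j(\theta)=\int\Psi_j(y,\theta)\,P(dy)$, where $$\Psi_1(y,\theta)=\mathbf 1_{\{\|G^{-1}(y-m)\|\le r\}}\,G^{-1}(y-m),\qquad \Psi_2(y,\theta)=\mathbf 1_{\{\|G^{-1}(y-m)\|\le r\}}\big(G^{-1}(y-m)(y-m)'G^{-1}-I\big),$$ $$\Psi_3(y,\theta)=\mathbf 1_{\{\|G^{-1}(y-m)\|\le r\}}-\gamma .$$ Let $\sigma_0$ be the Lebesgue surface measure on the sphere $\partial B_0$, $B_0=\{x\in\mathbb R^k:\|x\|\le\rho_0\}$ (counting measure on $\{-\rho_0,\rho_0\}$ if $k=1$), and let $\nu(d\omega)=\det(\Gamma_0)\,f(\Gamma_0\omega+\mu_0)\,\sigma_0(d\omega)$.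 Then $\Lambda_1,\Lambda_2,\Lambda_3$ are (Fréchet) differentiable at $\theta_0$, and their derivatives are the following linear maps in $(h,A,s)\in\mathbb R^k\times S(k)\times\mathbb R$. With $$b_{h,A,s}(\omega)=\frac{\omega'\Gamma_0^{-1}h}{\rho_0}+\frac{\omega'(\Gamma_0^{-1}A+A\Gamma_0^{-1})\omega}{2\rho_0}+s,$$ $$\Lambda_1'(\theta_0)(h,A,s)=-\gamma\,\Gamma_0^{-1}h+\int_{\partial B_0}b_{h,A,s}(\omega)\,\omega\,\nu(d\omega),$$ $$\Lambda_2'(\theta_0)(h,A,s)=-\gamma\,(\Gamma_0^{-1}A+A\Gamma_0^{-1})+\int_{\partial B_0}b_{h,A,s}(\omega)\,(\omega\omega'-I)\,\nu(d\omega),$$ $$\Lambda_3'(\theta_0)(h,A,s)=\int_{\partial B_0}b_{h,A,s}(\omega)\,\nu(d\omega).$$ -/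

import Mathlib

open MeasureTheory Set
open scoped Matrix.Norms.Elementwise

namespace MCD

noncomputable section

/-- Euclidean space `ℝ^k`. -/
abbrev Vec (k : ℕ) : Type := EuclideanSpace ℝ (Fin k)

/-- The space `M(k)` of real `k × k` matrices. It carries the entrywise maximum norm; since the
space is finite dimensional, the choice of a norm does not affect differentiability. -/
abbrev Mat (k : ℕ) : Type := Matrix (Fin k) (Fin k) ℝ

/-- The space `S(k)` of symmetric `k × k` matrices, with the norm inherited from `M(k)`. -/
def SymMat (k : ℕ) : Submodule ℝ (Mat k) where
  carrier := {A | A.IsSymm}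
  add_mem' ha hb := ha.add hb
  zero_mem' := Matrix.isSymm_zero
  smul_mem' c _ ha := ha.smul c

/-- The space `ℝ^k × S(k) × ℝ`. The parameter set `Θ` of all `(m, G, r)` with `G` positive definite
is an open subset of it, so that it is also the tangent space of `Θ` at each point. -/
abbrev Param (k : ℕ) : Type := Vec k × SymMat k × ℝ

variable {k : ℕ}

/-- The product `A x` of a matrix and a vector of `ℝ^k`. -/
def act (A : Mat k) (x : Vec k) : Vec k := Matrix.toEuclideanLin A x

/-- The `k × k` matrix `x x'`. -/
def outer (x : Vec k) : Mat k := Matrix.vecMulVec x.ofLp x.ofLp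

/-- The ellipsoid `E(μ, Σ, ρ) = {x : (x - μ)' Σ⁻¹ (x - μ) ≤ ρ²}`. -/
def ellipsoid (μ : Vec k) (S : Mat k) (ρ : ℝ) : Set (Vec k) :=
  {x | inner ℝ (x - μ) (act S⁻¹ (x - μ)) ≤ ρ ^ 2}

/-! ### The MCD functional -/

/-- The trimming functions: measurable `φ : ℝ^k → [0, 1]` with `∫ φ dP ≥ γ` and
`∫ ‖x‖² φ(x) P(dx) < ∞`. -/
structure IsTrimming (P : Measure (Vec k)) (γ : ℝ) (φ : Vec k → ℝ) : Prop where
  measurable : Measurable φ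
  mem_Icc : ∀ x, φ x ∈ Icc (0 : ℝ) 1
  mass : γ ≤ ∫ x, φ x ∂P
  moment : Integrable (fun x => ‖x‖ ^ 2 * φ x) P

/-- The trimmed mean `T_P(φ)`. -/
def trimMean (P : Measure (Vec k)) (φ : Vec k → ℝ) : Vec k :=
  (∫ x, φ x ∂P)⁻¹ • ∫ x, φ x • x ∂P

/-- The trimmed covariance matrix `C_P(φ)`. -/
def trimCov (P : Measure (Vec k)) (φ : Vec k → ℝ) : Mat k :=
  (∫ x, φ x ∂P)⁻¹ • ∫ x, φ x • outer (x - trimMean P φ) ∂P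

/-- `ρ = r_P(φ)`, the (finite) infimum of all `s > 0` with `P (E(T_P(φ), C_P(φ), s)) ≥ γ`. -/
def IsTrimRadius (P : Measure (Vec k)) (γ : ℝ) (φ : Vec k → ℝ) (ρ : ℝ) : Prop :=
  IsGLB {s : ℝ | 0 < s ∧ γ ≤ P.real (ellipsoid (trimMean P φ) (trimCov P φ) s)} ρ

/-- `φ` minimizes `det C_P` over all trimming functions. -/
def IsMinimizer (P : Measure (Vec k)) (γ : ℝ) (φ : Vec k → ℝ) : Prop :=
  IsTrimming P γ φ ∧ ∀ ψ, IsTrimming P γ ψ → (trimCov P φ).det ≤ (trimCov P ψ).det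

/-- `θ = (μ, Γ, ρ)` is an MCD functional at `P`: for some minimizer `φ` one has `μ = T_P(φ)`,
`Γ` is the positive definite square root of `C_P(φ)`, and `ρ = r_P(φ)`. -/
def IsMCD (P : Measure (Vec k)) (γ : ℝ) (θ : Param k) : Prop :=
  ∃ φ, IsMinimizer P γ φ ∧ θ.1 = trimMean P φ ∧
    (θ.2.1 : Mat k).PosDef ∧ (θ.2.1 : Mat k) * (θ.2.1 : Mat k) = trimCov P φ ∧
    IsTrimRadius P γ φ θ.2.2

/-- The MCD functional is uniquely defined at `P`: all minimizers have the same trimmed mean and the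
same trimmed covariance matrix. -/
def MCDUnique (P : Measure (Vec k)) (γ : ℝ) : Prop :=
  ∀ φ ψ, IsMinimizer P γ φ → IsMinimizer P γ ψ →
    trimMean P φ = trimMean P ψ ∧ trimCov P φ = trimCov P ψ

/-- `f` is a Lebesgue density of `P`. -/
structure IsDensity (P : Measure (Vec k)) (f : Vec k → ℝ) : Prop where
  measurable : Measurable f
  nonneg : ∀ x, 0 ≤ f x
  eq_withDensity : P = volume.withDensity fun x => ENNReal.ofReal (f x)

/-- Condition (B): `f` is continuous and strictly positive on an open neighborhood of the boundary
of `E(μ, Γ², ρ)`. -/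
def ConditionB (f : Vec k → ℝ) (θ : Param k) : Prop :=
  ∃ U : Set (Vec k), IsOpen U ∧
    frontier (ellipsoid θ.1 ((θ.2.1 : Mat k) * (θ.2.1 : Mat k)) θ.2.2) ⊆ U ∧
    ContinuousOn f U ∧ ∀ x ∈ U, 0 < f x

/-! ### The functions `Ψ` and `Λ` -/

/-- The standardized observation `G⁻¹ (y - m)`. -/
def standardize (y : Vec k) (θ : Param k) : Vec k := act (θ.2.1 : Mat k)⁻¹ (y - θ.1)

/-- The indicator function of `‖G⁻¹ (y - m)‖ ≤ r`. -/
def inside (y : Vec k) (θ : Param k) : ℝ :=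
  indicator {z : Vec k | ‖z‖ ≤ θ.2.2} (fun _ => (1 : ℝ)) (standardize y θ)

def Psi1 (y : Vec k) (θ : Param k) : Vec k := inside y θ • standardize y θ

/-- The second component of `Ψ`. Since `G` is symmetric, the outer product of `G⁻¹ (y - m)` with
itself is `G⁻¹ (y - m) (y - m)' G⁻¹`. -/
def Psi2 (y : Vec k) (θ : Param k) : Mat k :=
  inside y θ • (outer (standardize y θ) - 1)

def Psi3 (γ : ℝ) (y : Vec k) (θ : Param k) : ℝ := inside y θ - γ

def Lambda1 (P : Measure (Vec k)) (θ : Param k) : Vec k := ∫ y, Psi1 y θ ∂P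

def Lambda2 (P : Measure (Vec k)) (θ : Param k) : Mat k := ∫ y, Psi2 y θ ∂P

def Lambda3 (P : Measure (Vec k)) (γ : ℝ) (θ : Param k) : ℝ := ∫ y, Psi3 γ y θ ∂P

/-! ### The boundary measure -/

/-- Lebesgue surface measure on the sphere `∂B(0, ρ)` of `ℝ^k`, as a measure on `ℝ^k`: the image of
the surface measure of the unit sphere under `ω ↦ ρ ω`, multiplied by `ρ^(k-1)`.
(For `k = 1` it is the counting measure on `{-ρ, ρ}`.) -/
def surfaceMeasure (k : ℕ) (ρ : ℝ) : Measure (Vec k) :=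
  ENNReal.ofReal (ρ ^ (k - 1)) •
    Measure.map (fun ω : Metric.sphere (0 : Vec k) 1 => ρ • (ω : Vec k))
      (volume : Measure (Vec k)).toSphere

/-- The measure `ν(dω) = det(Γ) f(Γ ω + μ) σ(dω)` on `∂B(0, ρ)`, for `θ = (μ, Γ, ρ)` and `σ` the
surface measure on `∂B(0, ρ)`. -/
def nu (f : Vec k → ℝ) (θ : Param k) : Measure (Vec k) :=
  (surfaceMeasure k θ.2.2).withDensity fun ω =>
    ENNReal.ofReal ((θ.2.1 : Mat k).det * f (act (θ.2.1 : Mat k) ω + θ.1))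

/-- The scalar factor
`ω' Γ⁻¹ h / ρ + ω' (Γ⁻¹ A + A Γ⁻¹) ω / (2 ρ) + s`
of the boundary integrals, for `θ = (μ, Γ, ρ)`. -/
def boundaryFactor (θ : Param k) (h : Vec k) (A : Mat k) (s : ℝ) (ω : Vec k) : ℝ :=
  inner ℝ ω (act (θ.2.1 : Mat k)⁻¹ h) / θ.2.2
    + inner ℝ ω (act ((θ.2.1 : Mat k)⁻¹ * A + A * (θ.2.1 : Mat k)⁻¹) ω) / (2 * θ.2.2) + s

end

end MCD

/-! Substituting `y = Γ₀ x + μ₀` turns each `Λ_j` (up to the constant `γ` in `Λ₃`) into `∫ w(x)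
g(M_θ x + c_θ) dx` over the region `‖M_θ x + c_θ‖ ≤ r`. Here `w(x) = det(Γ₀) f(Γ₀ x + μ₀)`, `M_θ =
G⁻¹ Γ₀`, `c_θ = G⁻¹ (μ₀ - m)`, and `g(x)` is `x`, `x x' - I` or `1`. At `θ₀` the map is the identity
and the region is the ball `B₀`. The derivative is then of Reynolds type: a volume term, from
differentiating the integrand over the fixed ball, plus a surface term, from moving the boundary
(`exists_hasFDerivAt_integral_region`).

The surface term is found in polar coordinates. On the ray through a unit vector `ω`, the region is
an initial segment up to an error `o(‖θ - θ₀‖)`, uniformly in `ω`; its end moves with speed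
`boundarySpeed`, which is the factor `b` at `ρ₀ ω` (`ray_inter_region`, `boundaryFactor_eq`). Only
continuity of `w` at the sphere is needed, since the segments differ from those of the ball only
near the sphere.

The volume term is `∫_{B₀} w Dg(x)(-Γ₀⁻¹ A x - Γ₀⁻¹ h) dx`, which needs the moments of `w` on `B₀`
of order 0, 1 and 2: `γ`, `0` and `γ I`. They come from the optimality of the MCD. The indicator of
the MCD ellipsoid minimizes the mean squared Mahalanobis distance at mass `γ`. Hence its
standardized covariance has trace at most `k`, so determinant at most 1 by the inequality of
arithmetic and geometric means, and the indicator is again a minimizer. Uniqueness then forces its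
mean and covariance to be `μ₀` and `Σ₀` (`standardizedMoments_of_isMCD`). -/

namespace MCD

/-! ### Polar coordinates and the radial first order estimate -/

section Radial

open Metric Filter Topology

/-- Integration in polar coordinates. -/
theorem integral_polar {E V : Type*} [NormedAddCommGroup E] [NormedSpace ℝ E]
    [MeasurableSpace E] [BorelSpace E] [FiniteDimensional ℝ E] [Nontrivial E]
    [NormedAddCommGroup V] [NormedSpace ℝ V]
    (μ : Measure E) [μ.IsAddHaarMeasure] {F : E → V} (hF : Integrable F μ) :
    Integrable (fun ω : sphere (0 : E) 1 =>
        ∫ t in Ioi (0 : ℝ), t ^ (Module.finrank ℝ E - 1) • F (t • (ω : E))) μ.toSphere ∧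
      ∫ x, F x ∂μ = ∫ ω : sphere (0 : E) 1,
        (∫ t in Ioi (0 : ℝ), t ^ (Module.finrank ℝ E - 1) • F (t • (ω : E))) ∂μ.toSphere := by
  set n := Module.finrank ℝ E - 1
  have hmp := μ.measurePreserving_homeomorphUnitSphereProd
  have hemb := (homeomorphUnitSphereProd E).measurableEmbedding
  set G : sphere (0 : E) 1 × Ioi (0 : ℝ) → V := fun p => F ((p.2 : ℝ) • (p.1 : E)) with hG
  have hcomp : ∀ x : ({0}ᶜ : Set E), G (homeomorphUnitSphereProd E x) = F x := by
    intro x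
    simp only [hG]
    have hx : ‖(x : E)‖ ≠ 0 := norm_ne_zero_iff.2 x.2
    simp [smul_smul, mul_inv_cancel₀ hx]
  have hint : Integrable G (μ.toSphere.prod (Measure.volumeIoiPow n)) := by
    rw [← hmp.integrable_comp_emb hemb]
    have : G ∘ homeomorphUnitSphereProd E = F ∘ Subtype.val := funext hcomp
    rw [this, ← integrableOn_iff_comap_subtypeVal (measurableSet_singleton _).compl]
    exact hF.integrableOn
  have hinner : ∀ ω : sphere (0 : E) 1,
      ∫ t, G (ω, t) ∂Measure.volumeIoiPow n = ∫ t in Ioi (0 : ℝ), t ^ n • F (t • (ω : E)) := by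
    intro ω
    simp only [Measure.volumeIoiPow, ENNReal.ofReal, hG]
    rw [integral_withDensity_eq_integral_smul,
      integral_subtype_comap measurableSet_Ioi
        fun a : ℝ ↦ Real.toNNReal (a ^ n) • F (a • (ω : E)),
      setIntegral_congr_fun measurableSet_Ioi fun x hx ↦ ?_]
    · simp only [NNReal.smul_def]
      rw [Real.coe_toNNReal _ (pow_nonneg (le_of_lt hx) _)]
    · exact (measurable_subtype_coe.pow_const _).real_toNNReal
  refine ⟨by simpa only [hinner] using hint.integral_prod_left, ?_⟩
  calc ∫ x, F x ∂μ = ∫ x : ({(0)}ᶜ : Set E), F x.1 ∂(μ.comap (↑)) := by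
        rw [integral_subtype_comap (measurableSet_singleton _).compl F, restrict_compl_singleton]
    _ = ∫ p, G p ∂(μ.toSphere.prod (Measure.volumeIoiPow n)) := by
        rw [← hmp.integral_comp hemb]; simp only [hcomp]
    _ = _ := by rw [integral_prod _ hint]; simp only [hinner]

/-- A first order estimate for the integral of a function over the difference of two initial
segments of the half line. -/
theorem norm_integral_Ioi_indicator_sub_le {V : Type*} [NormedAddCommGroup V] [NormedSpace ℝ V]
    [CompleteSpace V]
    {φ : ℝ → V} {v : V} {A : Set ℝ} {ρ a e ε : ℝ} (hφ : StronglyMeasurable φ)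
    (hA : MeasurableSet A) (hρ : 0 ≤ ρ) (ha : |a| ≤ ρ) (he : 0 ≤ e)
    (hlow : ∀ t, 0 < t → t ≤ ρ + a - e → t ∈ A) (hup : ∀ t, 0 < t → t ∈ A → t ≤ ρ + a + e)
    (hclose : ∀ t, |t - ρ| ≤ |a| + e → ‖φ t - v‖ ≤ ε) :
    ‖(∫ t in Ioi (0 : ℝ), (A.indicator 1 t - (Iic ρ).indicator 1 t : ℝ) • φ t) - a • v‖
      ≤ 2 * ε * (|a| + e) + e * ‖v‖ := by
  set d : ℝ → ℝ := fun t => A.indicator 1 t - (Iic ρ).indicator 1 t with hd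
  set K : Set ℝ := Icc (ρ - (|a| + e)) (ρ + (|a| + e)) with hK
  have hae : 0 ≤ |a| + e := by positivity
  have hdm : Measurable d :=
    (measurable_one.indicator hA).sub (measurable_one.indicator measurableSet_Iic)
  have hd1 : ∀ t, ‖d t‖ ≤ 1 := by
    intro t
    simp only [hd]
    by_cases h1 : t ∈ A <;> by_cases h2 : t ∈ Iic ρ <;> simp [indicator, h1, h2]
  have hd0 : ∀ t, 0 < t → t ∉ K → d t = 0 := by
    intro t ht htK
    have h1 := abs_le.1 (le_refl |a|)
    have : t < ρ - (|a| + e) ∨ ρ + (|a| + e) < t := by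
      by_contra! h; exact htK h
    rcases this with h | h
    · have h1 : t ∈ A := hlow t ht (by linarith)
      have h2 : t ∈ Iic ρ := by simp only [mem_Iic]; linarith
      simp [hd, h1, h2]
    · have h1 : t ∉ A := fun h' => by linarith [hup t ht h']
      have h2 : t ∉ Iic ρ := by simp only [mem_Iic]; linarith
      simp [hd, h1, h2]
  have hKmem : ∀ t ∈ K, |t - ρ| ≤ |a| + e := by
    intro t ht; rw [abs_le]; constructor <;> linarith [ht.1, ht.2]
  -- Write `φ = v + (φ - v)`. The difference `d` of indicators lives on the window `K` of length `2
  -- (|a| + e)`, where the second part is at most `ε`; the first part contributes `v` times the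
  -- change of length.
  set g : ℝ → V := fun t => K.indicator (fun t => d t • (φ t - v)) t with hg
  have hgb : ∀ t ∈ K, ‖d t • (φ t - v)‖ ≤ ε := by
    intro t ht
    rw [norm_smul]
    calc ‖d t‖ * ‖φ t - v‖ ≤ 1 * ε := by
          gcongr
          · exact hd1 t
          · exact hclose t (hKmem t ht)
      _ = ε := one_mul _
  have hsplit : ∀ t ∈ Ioi (0 : ℝ), d t • φ t = g t + d t • v := by
    intro t ht
    by_cases h : t ∈ K
    · simp [hg, h, smul_sub]
    · simp [hg, h, hd0 t ht h]
  have hgi : Integrable (fun t => d t • (φ t - v)) (volume.restrict K) := by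
    refine Measure.integrableOn_of_bounded (M := ε) (by simp [hK]) ?_ ?_
    · exact (hdm.stronglyMeasurable.smul (hφ.sub stronglyMeasurable_const)).aestronglyMeasurable
    · filter_upwards [ae_restrict_mem measurableSet_Icc] with t ht using hgb t ht
  have hgi' : Integrable g := by
    rw [hg]
    exact (integrable_indicator_iff measurableSet_Icc).2 hgi
  have hAfin : volume (A ∩ Ioi 0) ≠ ⊤ := by
    refine ne_of_lt (lt_of_le_of_lt (measure_mono (t := Ioc 0 (ρ + a + e)) ?_) (by simp))
    exact fun t ht => ⟨ht.2, hup t ht.2 ht.1⟩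
  have hIA : ∫ t in Ioi (0 : ℝ), A.indicator (1 : ℝ → ℝ) t = volume.real (A ∩ Ioi 0) := by
    rw [integral_indicator_one hA, measureReal_restrict_apply hA]
  have hIB : ∫ t in Ioi (0 : ℝ), (Iic ρ).indicator (1 : ℝ → ℝ) t = ρ := by
    rw [integral_indicator_one measurableSet_Iic, measureReal_restrict_apply measurableSet_Iic,
      inter_comm, Ioi_inter_Iic]
    simp [hρ]
  have hiA : IntegrableOn (A.indicator (1 : ℝ → ℝ)) (Ioi 0) := by
    rw [IntegrableOn, integrable_indicator_iff hA, IntegrableOn, Measure.restrict_restrict hA]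
    exact integrableOn_const hAfin
  have hiB : IntegrableOn ((Iic ρ).indicator (1 : ℝ → ℝ)) (Ioi 0) := by
    rw [IntegrableOn, integrable_indicator_iff measurableSet_Iic, IntegrableOn,
      Measure.restrict_restrict measurableSet_Iic, inter_comm, Ioi_inter_Iic]
    exact integrableOn_const (by simp)
  have hdint : ∫ t in Ioi (0 : ℝ), d t = volume.real (A ∩ Ioi 0) - ρ := by
    rw [hd, integral_sub hiA hiB, hIA, hIB]
  have hI : ∫ t in Ioi (0 : ℝ), d t • φ t =
      (∫ t in Ioi (0 : ℝ), g t) + (volume.real (A ∩ Ioi 0) - ρ) • v := by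
    have hdi : IntegrableOn (fun t => d t • v) (Ioi 0) := Integrable.smul_const (hiA.sub hiB) v
    rw [setIntegral_congr_fun measurableSet_Ioi hsplit, integral_add hgi'.integrableOn hdi,
      integral_smul_const, hdint]
  -- `A ∩ (0, ∞)` lies between `(0, ρ + a - e]` and `(0, ρ + a + e]`. The assumption `|a| ≤ ρ` makes
  -- the right end of the longer interval nonnegative.
  have hvol : |volume.real (A ∩ Ioi 0) - ρ - a| ≤ e := by
    have h1 : ρ + a - e ≤ volume.real (A ∩ Ioi 0) := by
      have : volume.real (Ioc 0 (ρ + a - e)) ≤ volume.real (A ∩ Ioi 0) :=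
        measureReal_mono (fun t ht => ⟨hlow t ht.1 ht.2, ht.1⟩) hAfin
      refine le_trans ?_ this
      simp
    have h2 : volume.real (A ∩ Ioi 0) ≤ ρ + a + e := by
      have : volume.real (A ∩ Ioi 0) ≤ volume.real (Ioc 0 (ρ + a + e)) :=
        measureReal_mono (fun t ht => ⟨ht.2, hup t ht.2 ht.1⟩) (by simp)
      refine this.trans ?_
      have := abs_le.1 ha
      simp; linarith
    rw [abs_le]; constructor <;> linarith
  have hgnorm : ‖∫ t in Ioi (0 : ℝ), g t‖ ≤ 2 * ε * (|a| + e) := by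
    calc ‖∫ t in Ioi (0 : ℝ), g t‖ ≤ ∫ t in Ioi (0 : ℝ), ‖g t‖ := norm_integral_le_integral_norm _
      _ ≤ ∫ t, ‖g t‖ := setIntegral_le_integral hgi'.norm (Eventually.of_forall fun t => norm_nonneg _)
      _ = ∫ t in K, ‖d t • (φ t - v)‖ := by
          rw [← integral_indicator measurableSet_Icc]
          simp only [hg, norm_indicator_eq_indicator_norm, hK]
      _ ≤ ∫ t in K, ε := setIntegral_mono_on hgi.norm (integrableOn_const (by simp [hK]))
            measurableSet_Icc hgb
      _ = 2 * ε * (|a| + e) := by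
          simp only [integral_const, hK, measureReal_restrict_apply_univ, smul_eq_mul]
          rw [Real.volume_real_Icc_of_le (by linarith)]; ring
  rw [hI]
  calc ‖(∫ t in Ioi (0 : ℝ), g t) + (volume.real (A ∩ Ioi 0) - ρ) • v - a • v‖
      = ‖(∫ t in Ioi (0 : ℝ), g t) + (volume.real (A ∩ Ioi 0) - ρ - a) • v‖ := by
        congr 1; module
    _ ≤ ‖∫ t in Ioi (0 : ℝ), g t‖ + ‖(volume.real (A ∩ Ioi 0) - ρ - a) • v‖ := norm_add_le _ _
    _ ≤ _ := by
        rw [norm_smul]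
        gcongr
        exact hvol

end Radial

/-! ### Moving regions and their intersections with rays -/

section Region

open Metric Filter Topology

variable {E X : Type*} [NormedAddCommGroup E] [InnerProductSpace ℝ E]

/-- The intersection of a ray with the preimage of a ball under an affine map close to the identity:
if `‖N‖, ‖c‖, |r - ρ| ≤ η`, its length is `ρ + (r - ρ) - ⟪ω, c⟫ - ρ ⟪ω, N ω⟫ + O(η²)`. -/
theorem ray_inter_region {ρ : ℝ} (hρ : 0 < ρ) :
    ∃ C > 0, ∃ η₀ > 0, ∀ (N : E →L[ℝ] E) (c ω : E) (r η t : ℝ), ‖ω‖ = 1 → η ≤ η₀ → ‖N‖ ≤ η →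
      ‖c‖ ≤ η → |r - ρ| ≤ η → 0 < t →
      (‖t • ω + t • N ω + c‖ ≤ r →
        t ≤ ρ + (r - ρ - inner ℝ ω c - ρ * inner ℝ ω (N ω)) + C * η ^ 2) ∧
      (t ≤ ρ + (r - ρ - inner ℝ ω c - ρ * inner ℝ ω (N ω)) - C * η ^ 2 →
        ‖t • ω + t • N ω + c‖ ≤ r) := by
  -- `K η` will bound the displacement `τ` of the end of the segment, `L η` the deviation `u` from
  -- `ρ ω`, and `C₂ η²` the second order error of the norm there. The four bounds on `η` give, in
  -- turn, `1 + d ≥ 1/2`, `‖c‖ ≤ r`, `‖u‖ ≤ ρ` and `C η² ≤ η`.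
  set K : ℝ := 3 + ρ with hK
  set L : ℝ := 7 + 3 * ρ with hL
  set C₂ : ℝ := K + L ^ 2 / (2 * ρ) with hC₂
  have hKpos : 0 < K := by positivity
  have hLpos : 0 < L := by positivity
  have hC₂pos : 0 < C₂ := by positivity
  refine ⟨2 * (2 + ρ) + C₂, by positivity,
    min (1 / 2) (min (ρ / 2) (min (ρ / L) (1 / (2 * (2 + ρ) + C₂)))), by positivity, ?_⟩
  intro N c ω r η t hω hη hN hc hr ht
  have hη0 : 0 ≤ η := (norm_nonneg _).trans hc
  have hη1 : η ≤ 1 / 2 := hη.trans (min_le_left _ _)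
  have hη2 : η ≤ ρ / 2 := hη.trans ((min_le_right _ _).trans (min_le_left _ _))
  have hη3 : L * η ≤ ρ := by
    have : η ≤ ρ / L :=
      hη.trans ((min_le_right _ _).trans ((min_le_right _ _).trans (min_le_left _ _)))
    rw [le_div_iff₀ hLpos] at this; linarith
  have hη4 : (2 * (2 + ρ) + C₂) * η ≤ 1 := by
    have : η ≤ 1 / (2 * (2 + ρ) + C₂) :=
      hη.trans ((min_le_right _ _).trans ((min_le_right _ _).trans (min_le_right _ _)))
    rw [le_div_iff₀ (by positivity)] at this; linarith
  have hNω : ‖N ω‖ ≤ η := by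
    have := N.le_opNorm ω
    rw [hω, mul_one] at this; exact this.trans hN
  have hd : |inner ℝ ω (N ω)| ≤ η := by
    have := abs_real_inner_le_norm ω (N ω)
    rw [hω, one_mul] at this; exact this.trans hNω
  have hc' : |inner ℝ ω c| ≤ η := by
    have := abs_real_inner_le_norm ω c
    rw [hω, one_mul] at this; exact this.trans hc
  have hωω : inner ℝ ω ω = (1 : ℝ) := by rw [real_inner_self_eq_norm_sq, hω]; norm_num
  set d : ℝ := inner ℝ ω (N ω) with hd_def
  set p : ℝ := inner ℝ ω c with hp_def
  set β : ℝ := r - ρ - p - ρ * d with hβ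
  have hβb : |β| ≤ (2 + ρ) * η := by
    have h1 : |ρ * d| ≤ ρ * η := by rw [abs_mul, abs_of_pos hρ]; gcongr
    rw [abs_le] at *
    constructor <;> simp only [hβ] <;> linarith [hr.1, hr.2, hc'.1, hc'.2, h1.1, h1.2]
  have hd2 := abs_le.1 hd
  constructor
  -- Projecting on `ω` can only decrease the norm and leaves the linear inequality `t (1 + d) + p ≤
  -- r`. Replacing its solution by `ρ + β` costs at most `2 |β| η`, which is of second order.
  · intro h
    have h1 : t + t * d + p ≤ r := by
      have h2 := real_inner_le_norm ω (t • ω + t • N ω + c)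
      rw [hω, one_mul, inner_add_right, inner_add_right, inner_smul_right, inner_smul_right,
        hωω] at h2
      linarith
    have h2 : (t - ρ) * (1 + d) ≤ β := by simp only [hβ]; linarith
    have h3 : (t - ρ - β) * (1 + d) ≤ |β| * η := by
      have : -(β * d) ≤ |β| * η := by
        calc -(β * d) ≤ |β * d| := neg_le_abs _
          _ = |β| * |d| := abs_mul _ _
          _ ≤ |β| * η := by gcongr
      linarith
    have h4 : t - ρ - β ≤ 2 * (|β| * η) := by
      by_contra! h5
      have h6 : 0 ≤ |β| * η := by positivity
      nlinarith
    have h5 : |β| * η ≤ (2 + ρ) * η * η := by gcongr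
    have h6 : 0 ≤ C₂ * η ^ 2 := by positivity
    nlinarith
  -- The end point `t = ρ + τ` is shown to lie in the region by a second order bound for the norm
  -- near `ρ ω`. Smaller `t` follow by convexity, because the point `c` at `t = 0` also lies in the
  -- region.
  · intro h
    set C := 2 * (2 + ρ) + C₂ with hC
    set τ : ℝ := β - C * η ^ 2 with hτ
    have hCη : C * η ^ 2 ≤ η := by nlinarith
    have hCη0 : 0 ≤ C * η ^ 2 := by positivity
    have hτb : |τ| ≤ K * η := by
      rw [abs_le] at *
      constructor <;> simp only [hτ, hK] <;> linarith [hβb.1, hβb.2]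
    set v : E := (ρ + τ) • ω + (ρ + τ) • N ω + c with hv
    set u : E := τ • ω + ρ • N ω + c + τ • N ω with hu
    have hvu : v = ρ • ω + u := by simp only [hv, hu]; module
    have hub : ‖u‖ ≤ L * η := by
      have h1 : ‖u‖ ≤ ‖τ • ω‖ + ‖ρ • N ω‖ + ‖c‖ + ‖τ • N ω‖ := by
        refine (norm_add_le _ _).trans ?_
        gcongr
        refine (norm_add_le _ _).trans ?_
        gcongr
        exact norm_add_le _ _
      rw [norm_smul, norm_smul, norm_smul, hω, mul_one, Real.norm_eq_abs, Real.norm_eq_abs,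
        abs_of_pos hρ] at h1
      have h2 : |τ| * ‖N ω‖ ≤ K * η * η := by gcongr
      have h3 : ρ * ‖N ω‖ ≤ ρ * η := by gcongr
      have h4 : K * η * η ≤ K * η * 1 := by gcongr; linarith
      have : L * η = K * η + ρ * η + η + K * η * 1 := by simp only [hL, hK]; ring
      linarith
    have hωu : inner ℝ ω u = τ + ρ * d + p + τ * d := by
      simp only [hu, inner_add_right, inner_smul_right, hωω, ← hd_def, ← hp_def]; ring
    have hωu' : |inner ℝ ω u| ≤ ‖u‖ := by
      have := abs_real_inner_le_norm ω u
      rwa [hω, one_mul] at this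
    have hvnorm : ‖v‖ ≤ ρ + inner ℝ ω u + ‖u‖ ^ 2 / (2 * ρ) := by
      have hpos : 0 ≤ ρ + inner ℝ ω u := by linarith [(abs_le.1 hωu').1]
      refine (pow_le_pow_iff_left₀ (norm_nonneg v) (add_nonneg hpos (by positivity))
        two_ne_zero).1 ?_
      rw [hvu, norm_add_sq_real, norm_smul, hω, inner_smul_left, Real.norm_eq_abs, abs_of_pos hρ]
      have h1 : (ρ + inner ℝ ω u + ‖u‖ ^ 2 / (2 * ρ)) ^ 2 =
        ρ ^ 2 + 2 * ρ * inner ℝ ω u + ‖u‖ ^ 2 + (inner ℝ ω u + ‖u‖ ^ 2 / (2 * ρ)) ^ 2 := by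
        field_simp; ring
      rw [h1]
      simp only [conj_trivial]
      linarith [sq_nonneg (inner ℝ ω u + ‖u‖ ^ 2 / (2 * ρ))]
    have hvr : ‖v‖ ≤ r := by
      have h1 : ‖u‖ ^ 2 / (2 * ρ) ≤ (L * η) ^ 2 / (2 * ρ) := by gcongr
      have h2 : τ * d ≤ K * η * η := by
        calc τ * d ≤ |τ * d| := le_abs_self _
          _ = |τ| * |d| := abs_mul _ _
          _ ≤ K * η * η := by gcongr
      have h3 : (L * η) ^ 2 / (2 * ρ) + K * η * η = C₂ * η ^ 2 := by simp only [hC₂]; ring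
      have h4 : inner ℝ ω u = r - ρ - C * η ^ 2 + τ * d := by rw [hωu]; simp only [hτ, hβ]; ring
      have h5 : C * η ^ 2 = 2 * (2 + ρ) * η ^ 2 + C₂ * η ^ 2 := by simp only [hC]; ring
      have h6 : 0 ≤ 2 * (2 + ρ) * η ^ 2 := by positivity
      linarith
    have ht1 : t ≤ ρ + τ := by simp only [hτ]; linarith
    have hpos : 0 < ρ + τ := ht.trans_le ht1
    set l : ℝ := t / (ρ + τ) with hl
    have hl0 : 0 ≤ l := by positivity
    have hl1 : l ≤ 1 := (div_le_one hpos).2 ht1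
    have hlt : l * (ρ + τ) = t := div_mul_cancel₀ _ hpos.ne'
    have hcr : ‖c‖ ≤ r := by linarith [(abs_le.1 hr).1]
    have : t • ω + t • N ω + c = l • v + (1 - l) • c := by
      rw [← hlt]; simp only [hv]; module
    rw [this]
    calc ‖l • v + (1 - l) • c‖ ≤ ‖l • v‖ + ‖(1 - l) • c‖ := norm_add_le _ _
      _ = l * ‖v‖ + (1 - l) * ‖c‖ := by
        rw [norm_smul, norm_smul, Real.norm_eq_abs, Real.norm_eq_abs, abs_of_nonneg hl0,
          abs_of_nonneg (by linarith)]
      _ ≤ l * r + (1 - l) * r := by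
        have : 0 ≤ 1 - l := by linarith
        gcongr
      _ = r := by ring

/-- The preimage of the ball of radius `r θ` under the affine map `x ↦ M θ x + c θ`. -/
def region (M : X → E →L[ℝ] E) (c : X → E) (r : X → ℝ) (θ : X) : Set E :=
  {x | ‖M θ x + c θ‖ ≤ r θ}

variable [NormedAddCommGroup X] [NormedSpace ℝ X]

/-- The speed at which the boundary of `region M c r` moves in the direction of a unit vector `ω`,
when `region M c r` is the ball of radius `ρ` at the base point. -/
noncomputable def boundarySpeed (M' : X →L[ℝ] E →L[ℝ] E) (c' : X →L[ℝ] E) (r' : X →L[ℝ] ℝ) (ρ : ℝ)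
    (ω : E) : X →L[ℝ] ℝ :=
  r' - (innerSL ℝ ω).comp c' - ρ • (innerSL ℝ ω).comp ((ContinuousLinearMap.apply ℝ E ω).comp M')

theorem boundarySpeed_apply (M' : X →L[ℝ] E →L[ℝ] E) (c' : X →L[ℝ] E) (r' : X →L[ℝ] ℝ) (ρ : ℝ)
    (ω : E) (Δ : X) : boundarySpeed M' c' r' ρ ω Δ =
      r' Δ - inner ℝ ω (c' Δ) - ρ * inner ℝ ω (M' Δ ω) := by
  simp [boundarySpeed]

theorem continuous_boundarySpeed (M' : X →L[ℝ] E →L[ℝ] E) (c' : X →L[ℝ] E) (r' : X →L[ℝ] ℝ)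
    (ρ : ℝ) : Continuous (boundarySpeed M' c' r' ρ) := by
  unfold boundarySpeed
  fun_prop

variable {M : X → E →L[ℝ] E} {c : X → E} {r : X → ℝ} {θ₀ : X} {M' : X →L[ℝ] E →L[ℝ] E}
  {c' : X →L[ℝ] E} {r' : X →L[ℝ] ℝ} {ρ : ℝ}

/-- This is `ray_inter_region` with `η = K ‖θ - θ₀‖`, where `K` dominates the growth rates of `M`,
`c` and `r` at `θ₀`. One half of `ε` absorbs the quadratic error and the other half the
linearization errors; uniformity in `ω` comes from `‖ω‖ = 1`. -/
theorem eventually_ray_inter_region (hM : HasFDerivAt M M' θ₀) (hc : HasFDerivAt c c' θ₀)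
    (hr : HasFDerivAt r r' θ₀) (hM₀ : M θ₀ = 1) (hc₀ : c θ₀ = 0) (hr₀ : r θ₀ = ρ) (hρ : 0 < ρ)
    {ε : ℝ} (hε : 0 < ε) :
    ∀ᶠ θ in 𝓝 θ₀, ∀ ω : E, ‖ω‖ = 1 → ∀ t : ℝ, 0 < t →
      (t • ω ∈ region M c r θ →
        t ≤ ρ + boundarySpeed M' c' r' ρ ω (θ - θ₀) + ε * ‖θ - θ₀‖) ∧
      (t ≤ ρ + boundarySpeed M' c' r' ρ ω (θ - θ₀) - ε * ‖θ - θ₀‖ →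
        t • ω ∈ region M c r θ) := by
  obtain ⟨C, hC, η₀, hη₀, H⟩ := ray_inter_region (E := E) hρ
  obtain ⟨K₁, hK₁⟩ := hM.isBigO_sub.bound
  obtain ⟨K₂, hK₂⟩ := hc.isBigO_sub.bound
  obtain ⟨K₃, hK₃⟩ := hr.isBigO_sub.bound
  set K := max (max K₁ K₂) (max K₃ 1) with hK
  have hK1 : 1 ≤ K := (le_max_right _ _).trans (le_max_right _ _)
  -- The errors of `r`, `c` and `M` enter with weights `1`, `1` and `ρ`, so that their sum is `(2 +
  -- ρ) ε' = ε / 2`.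
  set ε' := ε / (2 * (2 + ρ)) with hε'
  have hε'pos : 0 < ε' := by positivity
  have h1 := hM.isLittleO.def hε'pos
  have h2 := hc.isLittleO.def hε'pos
  have h3 := hr.isLittleO.def hε'pos
  have hsmall : ∀ δ > 0, ∀ᶠ θ in 𝓝 θ₀, ‖θ - θ₀‖ < δ := fun δ hδ => by
    filter_upwards [ball_mem_nhds θ₀ hδ] with θ hθ using by rwa [← dist_eq_norm]
  filter_upwards [hK₁, hK₂, hK₃, h1, h2, h3, hsmall (η₀ / K) (by positivity),
    hsmall (ε / (2 * C * K ^ 2)) (by positivity)] with θ hK₁ hK₂ hK₃ h1 h2 h3 hs1 hs2 ω hω t ht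
  set Δ := θ - θ₀
  rw [hM₀] at hK₁ h1
  rw [hc₀, sub_zero] at hK₂ h2
  rw [hr₀] at hK₃ h3
  set N := M θ - 1 with hN
  have hMN : M θ (t • ω) + c θ = t • ω + t • N ω + c θ := by
    simp only [hN, map_smul, sub_apply, one_apply_eq_self]; module
  have hle : ∀ k, k ≤ K → k * ‖Δ‖ ≤ K * ‖Δ‖ := fun k hk => by gcongr
  have hη : K * ‖Δ‖ ≤ η₀ := by
    rw [lt_div_iff₀ (by positivity)] at hs1; linarith
  have key := H N (c θ) ω (r θ) (K * ‖Δ‖) t hω hη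
    (hK₁.trans (hle _ ((le_max_left _ _).trans (le_max_left _ _))))
    (hK₂.trans (hle _ ((le_max_right _ _).trans (le_max_left _ _))))
    (hK₃.trans (hle _ ((le_max_left _ _).trans (le_max_right _ _)))) ht
  have hquad : C * (K * ‖Δ‖) ^ 2 ≤ ε / 2 * ‖Δ‖ := by
    rw [lt_div_iff₀ (by positivity)] at hs2
    have : ‖Δ‖ * (2 * C * K ^ 2) * ‖Δ‖ ≤ ε * ‖Δ‖ := by gcongr
    linarith
  have hlin : |(r θ - ρ - inner ℝ ω (c θ) - ρ * inner ℝ ω (N ω)) -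
      boundarySpeed M' c' r' ρ ω Δ| ≤ ε / 2 * ‖Δ‖ := by
    rw [boundarySpeed_apply]
    have e1 : |inner ℝ ω (c θ - c' Δ)| ≤ ε' * ‖Δ‖ := by
      have := abs_real_inner_le_norm ω (c θ - c' Δ)
      rw [hω, one_mul] at this; exact this.trans h2
    have e2 : |inner ℝ ω ((N - M' Δ) ω)| ≤ ε' * ‖Δ‖ := by
      have := abs_real_inner_le_norm ω ((N - M' Δ) ω)
      have h5 := (N - M' Δ).le_opNorm ω
      rw [hω, one_mul] at this
      rw [hω, mul_one] at h5
      exact this.trans (h5.trans h1)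
    have e3 : |r θ - ρ - r' Δ| ≤ ε' * ‖Δ‖ := h3
    have e4 : |ρ * inner ℝ ω ((N - M' Δ) ω)| ≤ ρ * (ε' * ‖Δ‖) := by
      rw [abs_mul, abs_of_pos hρ]; gcongr
    have e5 : (r θ - ρ - inner ℝ ω (c θ) - ρ * inner ℝ ω (N ω)) -
        (r' Δ - inner ℝ ω (c' Δ) - ρ * inner ℝ ω (M' Δ ω)) =
        (r θ - ρ - r' Δ) - inner ℝ ω (c θ - c' Δ) - ρ * inner ℝ ω ((N - M' Δ) ω) := by
      have : (N - M' Δ) ω = N ω - M' Δ ω := rfl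
      rw [this, inner_sub_right, inner_sub_right]; ring
    have e6 : ε / 2 * ‖Δ‖ = ε' * ‖Δ‖ + ε' * ‖Δ‖ + ρ * (ε' * ‖Δ‖) := by
      simp only [hε']; field_simp; ring
    rw [e5, e6]
    rw [abs_le] at *
    constructor <;> linarith [e1.1, e1.2, e3.1, e3.2, e4.1, e4.2]
  have hlin' := abs_le.1 hlin
  simp only [region, mem_ofPred_eq, hMN]
  refine ⟨fun h => ?_, fun h => key.2 ?_⟩
  · have := key.1 h; linarith [hlin'.1, hlin'.2]
  · linarith [hlin'.1, hlin'.2]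

end Region

/-! ### The surface term: a fixed integrand over a moving region -/

section BoundaryDerivative

open Metric Filter Topology

theorem _root_.Continuous.integrable_sphere {E W : Type*} [NormedAddCommGroup E]
    [NormedSpace ℝ E] [FiniteDimensional ℝ E] [MeasurableSpace E] [BorelSpace E]
    [NormedAddCommGroup W]
    (μ : Measure (sphere (0 : E) 1)) [IsFiniteMeasure μ] {G : sphere (0 : E) 1 → W}
    (hG : Continuous G) : Integrable G μ :=
  hG.integrable_of_hasCompactSupport (HasCompactSupport.of_compactSpace G)

variable {V : Type*} [NormedAddCommGroup V] [NormedSpace ℝ V]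

theorem integrable_indicator_sub_smul {α : Type*} [MeasurableSpace α] {F : α → V}
    {μ : Measure α} {A B K : Set α}
    (hA : MeasurableSet A) (hB : MeasurableSet B) (hAK : A ⊆ K) (hBK : B ⊆ K)
    (hF : IntegrableOn F K μ) :
    Integrable (fun x => (A.indicator 1 x - B.indicator 1 x : ℝ) • F x) μ := by
  have h : (fun x => (A.indicator 1 x - B.indicator 1 x : ℝ) • F x) =
      fun x => A.indicator F x - B.indicator F x := by
    ext x
    by_cases h1 : x ∈ A <;> by_cases h2 : x ∈ B <;> simp [h1, h2]
  rw [h]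
  exact ((integrable_indicator_iff hA).2 (hF.mono_set hAK)).sub
    ((integrable_indicator_iff hB).2 (hF.mono_set hBK))

variable {E : Type*} [NormedAddCommGroup E] [InnerProductSpace ℝ E]

/-- The function `ω ↦ F (ρ ω)` on the unit sphere is continuous. -/
theorem continuous_comp_sphere {W : Type*} [TopologicalSpace W] {F : E → W} {ρ : ℝ} (hρ : 0 < ρ)
    (hF : ∀ x ∈ sphere (0 : E) ρ, ContinuousAt F x) :
    Continuous fun ω : sphere (0 : E) 1 => F (ρ • (ω : E)) := by
  rw [continuous_iff_continuousAt]
  intro ω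
  have hmem : ρ • (ω : E) ∈ sphere (0 : E) ρ := by
    rw [mem_sphere_zero_iff_norm, norm_smul, norm_eq_of_mem_sphere, mul_one, Real.norm_eq_abs,
      abs_of_pos hρ]
  exact ContinuousAt.comp (g := F) (f := fun ω : sphere (0 : E) 1 => ρ • (ω : E)) (hF _ hmem)
    (by fun_prop)

section

variable {X : Type*} {M : X → E →L[ℝ] E} {c : X → E} {r : X → ℝ} {θ₀ : X} {ρ : ℝ}

theorem isClosed_region (M : X → E →L[ℝ] E) (c : X → E) (r : X → ℝ) (θ : X) :
    IsClosed (region M c r θ) := by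
  unfold region
  exact isClosed_le (by fun_prop) continuous_const

theorem region_base (hM₀ : M θ₀ = 1) (hc₀ : c θ₀ = 0) (hr₀ : r θ₀ = ρ) :
    region M c r θ₀ = closedBall 0 ρ := by
  ext x; simp [region, hM₀, hc₀, hr₀]

/-- From `‖x‖ ≤ ‖M x + c‖ + ‖(M - 1) x‖ + ‖c‖` and `‖M - 1‖ < 1/2` one gets `‖x‖ / 2 ≤ r + ‖c‖ < 2
ρ`. This confines all the integrals to one compact ball. -/
theorem eventually_region_subset [TopologicalSpace X] (hM : ContinuousAt M θ₀) (hc : ContinuousAt c θ₀)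
    (hr : ContinuousAt r θ₀) (hM₀ : M θ₀ = 1) (hc₀ : c θ₀ = 0) (hr₀ : r θ₀ = ρ) (hρ : 0 < ρ) :
    ∀ᶠ θ in 𝓝 θ₀, region M c r θ ⊆ closedBall 0 (4 * ρ) := by
  have h1 : ∀ᶠ θ in 𝓝 θ₀, ‖M θ - 1‖ < 1 / 2 := by
    have : Tendsto (fun θ => ‖M θ - 1‖) (𝓝 θ₀) (𝓝 0) := by
      have := (hM.sub (continuousAt_const (y := (1 : E →L[ℝ] E)))).norm
      simpa [ContinuousAt, hM₀] using this
    exact this.eventually (gt_mem_nhds (by norm_num))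
  have h2 : ∀ᶠ θ in 𝓝 θ₀, r θ + ‖c θ‖ < 2 * ρ := by
    have : Tendsto (fun θ => r θ + ‖c θ‖) (𝓝 θ₀) (𝓝 ρ) := by
      have := hr.tendsto.add hc.tendsto.norm
      simpa only [hr₀, hc₀, norm_zero, add_zero] using this
    exact this.eventually (gt_mem_nhds (by linarith))
  filter_upwards [h1, h2] with θ h1 h2 x hx
  rw [mem_closedBall_zero_iff]
  have h3 : x = (M θ x + c θ) - (M θ - 1) x - c θ := by
    simp only [sub_apply, one_apply_eq_self]; abel
  have h4 : ‖x‖ ≤ ‖M θ x + c θ‖ + ‖(M θ - 1) x‖ + ‖c θ‖ := by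
    conv_lhs => rw [h3]
    exact (norm_sub_le _ _).trans (by gcongr; exact norm_sub_le _ _)
  have h5 : ‖(M θ - 1) x‖ ≤ 1 / 2 * ‖x‖ := (ContinuousLinearMap.le_opNorm _ _).trans (by gcongr)
  have h6 : ‖M θ x + c θ‖ ≤ r θ := hx
  linarith

end

variable [FiniteDimensional ℝ E]

/-- A function which is continuous at the points of a sphere is, near the sphere, uniformly close to
its values on the sphere. -/
theorem eventually_norm_radial_sub_le {F : E → V} {ρ : ℝ} (hρ : 0 < ρ) (n : ℕ)
    (hF : ∀ x ∈ sphere (0 : E) ρ, ContinuousAt F x) {ε : ℝ} (hε : 0 < ε) :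
    ∃ δ > 0, ∀ t : ℝ, |t - ρ| < δ → ∀ ω ∈ sphere (0 : E) 1,
      ‖t ^ n • F (t • ω) - ρ ^ n • F (ρ • ω)‖ ≤ ε := by
  have key : ∀ᶠ t in 𝓝 ρ, ∀ ω ∈ sphere (0 : E) 1,
      ‖t ^ n • F (t • ω) - ρ ^ n • F (ρ • ω)‖ ≤ ε := by
    refine (isCompact_sphere (0 : E) 1).eventually_forall_of_forall_eventually ?_
    intro ω hω
    have hmem : ρ • ω ∈ sphere (0 : E) ρ := by
      simp only [mem_sphere_zero_iff_norm] at *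
      rw [norm_smul, hω, mul_one, Real.norm_eq_abs, abs_of_pos hρ]
    have hFω := hF _ hmem
    have c1 : ContinuousAt (fun z : ℝ × E => z.1 ^ n • F (z.1 • z.2)) (ρ, ω) := by
      refine ContinuousAt.smul (by fun_prop) ?_
      exact ContinuousAt.comp (g := F) (f := fun z : ℝ × E => z.1 • z.2) hFω (by fun_prop)
    have c2 : ContinuousAt (fun z : ℝ × E => ρ ^ n • F (ρ • z.2)) (ρ, ω) := by
      refine ContinuousAt.smul (by fun_prop) ?_
      exact ContinuousAt.comp (g := F) (f := fun z : ℝ × E => ρ • z.2) hFω (by fun_prop)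
    have c3 : Tendsto (fun z : ℝ × E => ‖z.1 ^ n • F (z.1 • z.2) - ρ ^ n • F (ρ • z.2)‖)
        (𝓝 (ρ, ω)) (𝓝 0) := by
      have := (c1.tendsto.sub c2.tendsto).norm
      simpa only [sub_self, norm_zero] using this
    exact (c3.eventually (gt_mem_nhds hε)).mono fun z hz => hz.le
  obtain ⟨δ, hδ, h⟩ := Metric.eventually_nhds_iff.1 key
  exact ⟨δ, hδ, fun t ht => h (by rwa [Real.dist_eq])⟩

variable [Nontrivial E] [MeasurableSpace E] [BorelSpace E] [CompleteSpace V]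
  {X : Type*} [NormedAddCommGroup X] [NormedSpace ℝ X]
  {M : X → E →L[ℝ] E} {c : X → E} {r : X → ℝ} {θ₀ : X} {M' : X →L[ℝ] E →L[ℝ] E}
  {c' : X →L[ℝ] E} {r' : X →L[ℝ] ℝ} {ρ : ℝ}

/-- The derivative of the integral of a fixed function over a moving region. -/
theorem isLittleO_integral_region (μ : Measure E) [μ.IsAddHaarMeasure]
    (hM : HasFDerivAt M M' θ₀) (hc : HasFDerivAt c c' θ₀)
    (hr : HasFDerivAt r r' θ₀) (hM₀ : M θ₀ = 1) (hc₀ : c θ₀ = 0) (hr₀ : r θ₀ = ρ) (hρ : 0 < ρ)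
    {F : E → V} (hFm : StronglyMeasurable F) (hFi : IntegrableOn F (closedBall 0 (4 * ρ)) μ)
    (hF : ∀ x ∈ sphere (0 : E) ρ, ContinuousAt F x) :
    (fun θ => (∫ x, ((region M c r θ).indicator 1 x - (closedBall 0 ρ).indicator 1 x : ℝ) • F x ∂μ)
      - ∫ ω : sphere (0 : E) 1, boundarySpeed M' c' r' ρ (ω : E) (θ - θ₀) •
          (ρ ^ (Module.finrank ℝ E - 1) • F (ρ • (ω : E))) ∂μ.toSphere)
      =o[𝓝 θ₀] fun θ => θ - θ₀ := by
  set n := Module.finrank ℝ E - 1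
  set b := boundarySpeed M' c' r' ρ
  have hbcont : Continuous fun ω : sphere (0 : E) 1 => b ω :=
    (continuous_boundarySpeed M' c' r' ρ).comp continuous_subtype_val
  have hvcont : Continuous fun ω : sphere (0 : E) 1 => ρ ^ n • F (ρ • (ω : E)) :=
    (continuous_comp_sphere hρ hF).const_smul _
  obtain ⟨Cb, hCb⟩ : ∃ C, ∀ ω : sphere (0 : E) 1, ‖b ω‖ ≤ C := by
    obtain ⟨C, hC⟩ := isCompact_univ.exists_bound_of_continuousOn hbcont.continuousOn
    exact ⟨C, fun ω => hC ω (mem_univ _)⟩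
  obtain ⟨Cv, hCv⟩ : ∃ C, ∀ ω : sphere (0 : E) 1, ‖ρ ^ n • F (ρ • (ω : E))‖ ≤ C := by
    obtain ⟨C, hC⟩ := isCompact_univ.exists_bound_of_continuousOn hvcont.continuousOn
    exact ⟨C, fun ω => hC ω (mem_univ _)⟩
  obtain ⟨ω₀⟩ : Nonempty (sphere (0 : E) 1) := by
    obtain ⟨x, hx⟩ := NormedSpace.sphere_nonempty (x := (0 : E)) (r := 1).2 zero_le_one
    exact ⟨⟨x, hx⟩⟩
  have hCb0 : 0 ≤ Cb := (norm_nonneg _).trans (hCb ω₀)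
  have hCv0 : 0 ≤ Cv := (norm_nonneg _).trans (hCv ω₀)
  set S := μ.toSphere.real univ
  have hS0 : 0 ≤ S := measureReal_nonneg
  rw [Asymptotics.isLittleO_iff]
  intro κ hκ
  -- The error on a single ray will be `ε (2 (Cb + 1) + Cv) ‖Δ‖`, and integration over the sphere
  -- multiplies it by `S`. The bound `ε ≤ 1` keeps the window `|a| + e` within `(Cb + 1) ‖Δ‖`.
  set ε : ℝ := min 1 (κ / ((2 * (Cb + 1) + Cv) * S + 1)) with hεdef
  have hε : 0 < ε := by positivity
  have hε1 : ε ≤ 1 := min_le_left _ _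
  have hεκ : ε * ((2 * (Cb + 1) + Cv) * S) ≤ κ := by
    have h1 : ε ≤ κ / ((2 * (Cb + 1) + Cv) * S + 1) := min_le_right _ _
    rw [le_div_iff₀ (by positivity)] at h1
    linarith
  obtain ⟨δ, hδ, hclose⟩ := eventually_norm_radial_sub_le hρ n hF hε
  have hsmall : ∀ δ > 0, ∀ᶠ θ in 𝓝 θ₀, ‖θ - θ₀‖ < δ := fun δ hδ => by
    filter_upwards [ball_mem_nhds θ₀ hδ] with θ hθ using by rwa [← dist_eq_norm]
  filter_upwards [eventually_ray_inter_region hM hc hr hM₀ hc₀ hr₀ hρ hε,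
    eventually_region_subset hM.continuousAt hc.continuousAt hr.continuousAt hM₀ hc₀ hr₀ hρ,
    -- The first threshold keeps the radial window within `δ` of `ρ`, where the integrand is close
    -- to its value on the sphere; the second gives `|a| ≤ ρ`.
    hsmall (δ / (Cb + 1)) (by positivity), hsmall (ρ / (Cb + 1)) (by positivity)]
    with θ hray hsub hs1 hs2
  set Δ := θ - θ₀
  rw [lt_div_iff₀ (by positivity)] at hs1 hs2
  set A := region M c r θ
  have hAm : MeasurableSet A := (isClosed_region M c r θ).measurableSet
  have hG := integrable_indicator_sub_smul (μ := μ) hAm measurableSet_closedBall hsub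
    (closedBall_subset_closedBall (by linarith : ρ ≤ 4 * ρ)) hFi
  obtain ⟨hI, hpolar⟩ := integral_polar μ hG
  have hbint : Integrable (fun ω : sphere (0 : E) 1 => b ω Δ • (ρ ^ n • F (ρ • (ω : E))))
      μ.toSphere := by
    apply Continuous.integrable_sphere
    exact (hbcont.clm_apply continuous_const).smul hvcont
  rw [hpolar, ← integral_sub hI hbint]
  have hpt : ∀ ω : sphere (0 : E) 1,
      ‖(∫ t in Ioi (0 : ℝ), t ^ n •
        ((A.indicator 1 (t • (ω : E)) - (closedBall 0 ρ).indicator 1 (t • (ω : E)) : ℝ) •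
          F (t • (ω : E)))) - b ω Δ • (ρ ^ n • F (ρ • (ω : E)))‖ ≤
        ε * (2 * (Cb + 1) + Cv) * ‖Δ‖ := by
    intro ω
    have hω : ‖(ω : E)‖ = 1 := norm_eq_of_mem_sphere ω
    set A₁ : Set ℝ := (fun t : ℝ => t • (ω : E)) ⁻¹' A with hA₁
    have hrew : ∫ t in Ioi (0 : ℝ), t ^ n •
        ((A.indicator 1 (t • (ω : E)) - (closedBall 0 ρ).indicator 1 (t • (ω : E)) : ℝ) •
          F (t • (ω : E))) =
        ∫ t in Ioi (0 : ℝ), (A₁.indicator 1 t - (Iic ρ).indicator 1 t : ℝ) •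
          (t ^ n • F (t • (ω : E))) := by
      refine setIntegral_congr_fun measurableSet_Ioi fun t ht => ?_
      have h1 : A.indicator (1 : E → ℝ) (t • (ω : E)) = A₁.indicator 1 t := by
        by_cases h : t • (ω : E) ∈ A
        · simp [h, show t ∈ A₁ from h]
        · simp [h, show t ∉ A₁ from h]
      have h2 : (closedBall (0 : E) ρ).indicator (1 : E → ℝ) (t • (ω : E)) =
          (Iic ρ).indicator 1 t := by
        simp [indicator, norm_smul, abs_of_pos (show 0 < t from ht)]
      simp only [h1, h2]
      rw [smul_comm]
    have hb : |b ω Δ| ≤ Cb * ‖Δ‖ := ((b ω).le_opNorm Δ).trans (by gcongr; exact hCb ω)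
    have hsum : |b ω Δ| + ε * ‖Δ‖ ≤ ‖Δ‖ * (Cb + 1) := by
      have : ε * ‖Δ‖ ≤ 1 * ‖Δ‖ := by gcongr
      linarith
    rw [hrew]
    have hmeas : StronglyMeasurable fun t : ℝ => t ^ n • F (t • (ω : E)) :=
      (by fun_prop : Continuous fun t : ℝ => t ^ n).stronglyMeasurable.smul
        (hFm.comp_measurable (by fun_prop))
    have hA₁m : MeasurableSet A₁ := hAm.preimage (by fun_prop)
    have he : 0 ≤ ε * ‖Δ‖ := by positivity
    -- The radial estimate is used with `a = b ω Δ`, `e = ε ‖Δ‖` and `φ t = t ^ n • F (t ω)`, the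
    -- Jacobian included.
    refine (norm_integral_Ioi_indicator_sub_le (ε := ε) hmeas hA₁m hρ.le
      (by linarith) he (fun t ht h => (hray ω hω t ht).2 h)
      (fun t ht h => (hray ω hω t ht).1 h)
      (fun t ht => hclose t (by linarith) ω ω.2)).trans ?_
    calc 2 * ε * (|b ω Δ| + ε * ‖Δ‖) + ε * ‖Δ‖ * ‖ρ ^ n • F (ρ • (ω : E))‖
        ≤ 2 * ε * (‖Δ‖ * (Cb + 1)) + ε * ‖Δ‖ * Cv := by gcongr; exact hCv ω
      _ = _ := by ring
  refine (norm_integral_le_of_norm_le_const (Eventually.of_forall hpt)).trans ?_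
  calc ε * (2 * (Cb + 1) + Cv) * ‖Δ‖ * S = ε * ((2 * (Cb + 1) + Cv) * S) * ‖Δ‖ := by ring
    _ ≤ κ * ‖Δ‖ := by gcongr

end BoundaryDerivative

/-! ### Integrand and region both moving -/

section RegionDerivative

open Metric Filter Topology

variable {E : Type*} [NormedAddCommGroup E] [InnerProductSpace ℝ E]

/-- Away from the sphere of radius `ρ`, a point eventually lies in the region if and only if it lies
in the ball of radius `ρ`. -/
theorem eventually_mem_region_iff {X : Type*} [TopologicalSpace X] {M : X → E →L[ℝ] E}
    {c : X → E} {r : X → ℝ} {θ₀ : X} {ρ : ℝ} (hM : ContinuousAt M θ₀) (hc : ContinuousAt c θ₀)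
    (hr : ContinuousAt r θ₀) (hM₀ : M θ₀ = 1) (hc₀ : c θ₀ = 0) (hr₀ : r θ₀ = ρ) {x : E}
    (hx : ‖x‖ ≠ ρ) : ∀ᶠ θ in 𝓝 θ₀, (x ∈ region M c r θ ↔ x ∈ closedBall 0 ρ) := by
  have h1 : Tendsto (fun θ => ‖M θ x + c θ‖ - r θ) (𝓝 θ₀) (𝓝 (‖x‖ - ρ)) := by
    have h2 : ContinuousAt (fun θ => M θ x) θ₀ := hM.clm_apply continuousAt_const
    have := (h2.tendsto.add hc.tendsto).norm.sub hr.tendsto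
    simpa only [hM₀, hc₀, hr₀, one_apply_eq_self, add_zero] using this
  simp only [region, mem_ofPred_eq, mem_closedBall_zero_iff]
  rcases lt_or_gt_of_ne hx with h | h
  · filter_upwards [h1.eventually (gt_mem_nhds (sub_neg.2 h))] with θ hθ
    exact iff_of_true (by linarith) h.le
  · filter_upwards [h1.eventually (lt_mem_nhds (sub_pos.2 h))] with θ hθ
    exact iff_of_false (by linarith) (by linarith)

variable [FiniteDimensional ℝ E] {V : Type*} [NormedAddCommGroup V] [NormedSpace ℝ V]
  {X : Type*} [NormedAddCommGroup X] [NormedSpace ℝ X]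
  {M : X → E →L[ℝ] E} {c : X → E} {r : X → ℝ} {θ₀ : X} {M' : X →L[ℝ] E →L[ℝ] E}
  {c' : X →L[ℝ] E} {r' : X →L[ℝ] ℝ} {ρ : ℝ}

/-- A `C¹` function is Lipschitz on the compact convex ball of radius `R + 1`, and points of the
ball of radius `R` move by at most `K ‖θ - θ₀‖`. The radius `R + 1` leaves room for the moved
points. -/
theorem exists_eventually_norm_comp_sub_le {g : E → V} (hg : ContDiff ℝ 1 g)
    (hM : HasFDerivAt M M' θ₀) (hc : HasFDerivAt c c' θ₀)
    (hM₀ : M θ₀ = 1) (hc₀ : c θ₀ = 0) {R : ℝ} (hR : 0 < R) :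
    ∃ L : ℝ, 0 ≤ L ∧ ∀ᶠ θ in 𝓝 θ₀, ∀ x ∈ closedBall (0 : E) R,
      ‖g (M θ x + c θ) - g x‖ ≤ L * ‖θ - θ₀‖ := by
  obtain ⟨K₁, hK₁⟩ := hM.isBigO_sub.bound
  obtain ⟨K₂, hK₂⟩ := hc.isBigO_sub.bound
  obtain ⟨Λ, hΛ⟩ := (hg.contDiffOn (s := closedBall (0 : E) (R + 1))).exists_lipschitzOnWith
    one_ne_zero (convex_closedBall _ _) (isCompact_closedBall _ _)
  set K := |K₁| * R + |K₂| with hKdef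
  refine ⟨Λ * K, by positivity, ?_⟩
  have hsmall : ∀ᶠ θ in 𝓝 θ₀, ‖θ - θ₀‖ < 1 / (K + 1) := by
    filter_upwards [ball_mem_nhds θ₀ (show 0 < 1 / (K + 1) by positivity)] with θ hθ
    rwa [← dist_eq_norm]
  filter_upwards [hK₁, hK₂, hsmall] with θ hK₁ hK₂ hs x hx
  rw [lt_div_iff₀ (by positivity)] at hs
  rw [hM₀] at hK₁
  rw [hc₀, sub_zero] at hK₂
  have hxR : ‖x‖ ≤ R := by simpa using hx
  have hz : ‖M θ x + c θ - x‖ ≤ K * ‖θ - θ₀‖ := by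
    have h1 : M θ x + c θ - x = (M θ - 1) x + c θ := by
      simp only [sub_apply, one_apply_eq_self]; abel
    rw [h1]
    calc ‖(M θ - 1) x + c θ‖ ≤ ‖M θ - 1‖ * ‖x‖ + ‖c θ‖ :=
          (norm_add_le _ _).trans (by gcongr; exact ContinuousLinearMap.le_opNorm _ _)
      _ ≤ (|K₁| * ‖θ - θ₀‖) * R + |K₂| * ‖θ - θ₀‖ := by
          gcongr
          · exact hK₁.trans (by gcongr; exact le_abs_self _)
          · exact hK₂.trans (by gcongr; exact le_abs_self _)
      _ = K * ‖θ - θ₀‖ := by simp only [hKdef]; ring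
  have hxmem : x ∈ closedBall (0 : E) (R + 1) := by
    rw [mem_closedBall_zero_iff]; linarith
  have hzmem : M θ x + c θ ∈ closedBall (0 : E) (R + 1) := by
    rw [mem_closedBall_zero_iff]
    have h2 : ‖M θ x + c θ‖ ≤ ‖M θ x + c θ - x‖ + ‖x‖ := norm_le_norm_sub_add _ _
    have h3 := norm_nonneg (θ - θ₀)
    linarith
  calc ‖g (M θ x + c θ) - g x‖ ≤ Λ * ‖M θ x + c θ - x‖ := hΛ.norm_sub_le hzmem hxmem
    _ ≤ Λ * (K * ‖θ - θ₀‖) := by gcongr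
    _ = _ := by ring

variable [MeasurableSpace E] [BorelSpace E]

theorem integrableOn_smul_continuous {μ : Measure E} {w : E → ℝ} (hw : Integrable w μ) {h : E → V}
    (hh : Continuous h) {K : Set E} (hK : IsCompact K) :
    IntegrableOn (fun x => w x • h x) K μ := by
  obtain ⟨C, hC⟩ := hK.exists_bound_of_continuousOn hh.continuousOn
  have : SecondCountableTopology E := secondCountable_of_proper
  refine Integrable.mono' (hw.norm.mul_const C).integrableOn
    (hw.aestronglyMeasurable.smul hh.aestronglyMeasurable).restrict ?_
  filter_upwards [ae_restrict_mem hK.measurableSet] with x hx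
  rw [norm_smul]
  gcongr
  exact hC x hx

/-- Differentiation under the integral sign over a fixed ball. -/
theorem hasFDerivAt_integral_closedBall {μ : Measure E} {w : E → ℝ} (hw : Integrable w μ)
    {g : E → V} (hg : ContDiff ℝ 1 g) (hM : HasFDerivAt M M' θ₀) (hc : HasFDerivAt c c' θ₀)
    (hM₀ : M θ₀ = 1) (hc₀ : c θ₀ = 0) (hρ : 0 < ρ) :
    Integrable (fun x => w x • (fderiv ℝ g x).comp ((ContinuousLinearMap.apply ℝ E x).comp M' + c'))
        (μ.restrict (closedBall 0 ρ)) ∧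
      HasFDerivAt (fun θ => ∫ x in closedBall 0 ρ, w x • g (M θ x + c θ) ∂μ)
        (∫ x in closedBall 0 ρ,
          w x • (fderiv ℝ g x).comp ((ContinuousLinearMap.apply ℝ E x).comp M' + c') ∂μ) θ₀ := by
  have : SecondCountableTopology E := secondCountable_of_proper
  obtain ⟨L, hL, hLip⟩ := exists_eventually_norm_comp_sub_le hg hM hc hM₀ hc₀ hρ
  have hgc := hg.continuous
  have hder : Continuous fun x =>
      (fderiv ℝ g x).comp ((ContinuousLinearMap.apply ℝ E x).comp M' + c') := by
    have := hg.continuous_fderiv one_ne_zero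
    fun_prop
  refine hasFDerivAt_integral_of_dominated_loc_of_lip' (bound := fun x => ‖w x‖ * L) hLip
    ?_ ?_ ?_ ?_ ?_ ?_
  · intro θ _
    exact (hw.aestronglyMeasurable.smul
      (by fun_prop : Continuous fun x => g (M θ x + c θ)).aestronglyMeasurable).restrict
  · exact integrableOn_smul_continuous hw (by fun_prop) (isCompact_closedBall _ _)
  · exact (hw.aestronglyMeasurable.smul hder.aestronglyMeasurable).restrict
  · filter_upwards [ae_restrict_mem measurableSet_closedBall] with x hx θ hθ
    rw [← smul_sub, norm_smul, mul_assoc, hM₀, hc₀, one_apply_eq_self, add_zero]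
    gcongr
    exact hθ x hx
  · exact (hw.norm.mul_const L).restrict
  · refine Eventually.of_forall fun x => HasFDerivAt.const_smul ?_ _
    have h1 : HasFDerivAt (fun θ => M θ x + c θ) ((ContinuousLinearMap.apply ℝ E x).comp M' + c')
        θ₀ := ((ContinuousLinearMap.apply ℝ E x).hasFDerivAt.comp θ₀ hM).add hc
    have h2 : HasFDerivAt g (fderiv ℝ g x) (M θ₀ x + c θ₀) := by
      rw [hM₀, hc₀, one_apply_eq_self, add_zero]
      exact (hg.differentiable one_ne_zero x).hasFDerivAt
    exact h2.comp θ₀ h1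

variable [Nontrivial E]

/-- Dominated convergence: off the sphere, which is a null set, membership in the region is
eventually the same as membership in the ball. -/
theorem tendsto_integral_indicator_region_sub {X : Type*} [NormedAddCommGroup X]
    {M : X → E →L[ℝ] E} {c : X → E} {r : X → ℝ} {θ₀ : X} {ρ : ℝ} (μ : Measure E) [μ.IsAddHaarMeasure]
    (hM : ContinuousAt M θ₀) (hc : ContinuousAt c θ₀)
    (hr : ContinuousAt r θ₀) (hM₀ : M θ₀ = 1) (hc₀ : c θ₀ = 0) (hr₀ : r θ₀ = ρ)
    {w : E → ℝ} (hw : Integrable w μ) :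
    Tendsto (fun θ => ∫ x,
      ‖((region M c r θ).indicator 1 x - (closedBall 0 ρ).indicator 1 x : ℝ)‖ * ‖w x‖ ∂μ)
      (𝓝 θ₀) (𝓝 0) := by
  have hd1 : ∀ θ x,
      ‖((region M c r θ).indicator 1 x - (closedBall 0 ρ).indicator 1 x : ℝ)‖ ≤ 1 := by
    intro θ x
    by_cases h1 : x ∈ region M c r θ <;> by_cases h2 : x ∈ closedBall (0 : E) ρ <;>
      simp only [h1, h2, indicator_of_mem, indicator_of_notMem, not_false_eq_true,
        Pi.one_apply] <;> norm_num
  have : ∫ x : E, (0 : ℝ) ∂μ = 0 := integral_zero _ _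
  rw [← this]
  refine tendsto_integral_filter_of_dominated_convergence (fun x => ‖w x‖) ?_ ?_ hw.norm ?_
  · refine Eventually.of_forall fun θ => ?_
    have hdm : Measurable fun x =>
        ((region M c r θ).indicator 1 x - (closedBall 0 ρ).indicator 1 x : ℝ) :=
      (measurable_one.indicator (isClosed_region M c r θ).measurableSet).sub
        (measurable_one.indicator measurableSet_closedBall)
    exact hdm.norm.aestronglyMeasurable.mul hw.norm.aestronglyMeasurable
  · refine Eventually.of_forall fun θ => Eventually.of_forall fun x => ?_
    rw [norm_mul, norm_norm, norm_norm]
    exact mul_le_of_le_one_left (norm_nonneg _) (hd1 θ x)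
  · have hsph : ∀ᵐ x ∂μ, x ∉ sphere (0 : E) ρ :=
      measure_eq_zero_iff_ae_notMem.1 (Measure.addHaar_sphere μ 0 ρ)
    filter_upwards [hsph] with x hx
    refine tendsto_const_nhds.congr' ?_
    filter_upwards [eventually_mem_region_iff hM hc hr hM₀ hc₀ hr₀
      (by simpa using hx : ‖x‖ ≠ ρ)] with θ hθ
    by_cases h : x ∈ closedBall (0 : E) ρ
    · simp only [h, hθ.2 h, indicator_of_mem, sub_self, norm_zero, zero_mul]
    · simp only [h, mt hθ.1 h, indicator_of_notMem, not_false_eq_true, sub_self, norm_zero,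
        zero_mul]

variable [CompleteSpace V]

/-- The derivative of an integral in which both the integrand and the domain of integration depend
on the parameter. -/
theorem exists_hasFDerivAt_integral_region (μ : Measure E) [μ.IsAddHaarMeasure]
    (hM : HasFDerivAt M M' θ₀) (hc : HasFDerivAt c c' θ₀)
    (hr : HasFDerivAt r r' θ₀) (hM₀ : M θ₀ = 1) (hc₀ : c θ₀ = 0) (hr₀ : r θ₀ = ρ) (hρ : 0 < ρ)
    {w : E → ℝ} (hwm : Measurable w) (hwi : Integrable w μ)
    (hw : ∀ x ∈ sphere (0 : E) ρ, ContinuousAt w x) {g : E → V} (hg : ContDiff ℝ 1 g) :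
    ∃ D : X →L[ℝ] V,
      HasFDerivAt (fun θ => ∫ x in region M c r θ, w x • g (M θ x + c θ) ∂μ) D θ₀ ∧
      ∀ Δ, D Δ = (∫ x in closedBall 0 ρ, w x • fderiv ℝ g x (M' Δ x + c' Δ) ∂μ) +
        ∫ ω : sphere (0 : E) 1, boundarySpeed M' c' r' ρ (ω : E) Δ •
          (ρ ^ (Module.finrank ℝ E - 1) • (w (ρ • (ω : E)) • g (ρ • (ω : E)))) ∂μ.toSphere := by
  have : SecondCountableTopology E := secondCountable_of_proper
  set n := Module.finrank ℝ E - 1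
  have hgc := hg.continuous
  set F : E → V := fun x => w x • g x with hFdef
  have hFcont : ∀ x ∈ sphere (0 : E) ρ, ContinuousAt F x := fun x hx =>
    (hw x hx).smul hgc.continuousAt
  have hFm : StronglyMeasurable F := hwm.stronglyMeasurable.smul hgc.stronglyMeasurable
  have hFi : IntegrableOn F (closedBall 0 (4 * ρ)) μ :=
    integrableOn_smul_continuous hwi hgc (isCompact_closedBall _ _)
  obtain ⟨hi₁, hD₁⟩ := hasFDerivAt_integral_closedBall hwi hg hM hc hM₀ hc₀ hρ
  set D₁ := ∫ x in closedBall 0 ρ,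
    w x • (fderiv ℝ g x).comp ((ContinuousLinearMap.apply ℝ E x).comp M' + c') ∂μ
  set D₂ := ∫ ω : sphere (0 : E) 1,
    (boundarySpeed M' c' r' ρ (ω : E)).smulRight (ρ ^ n • F (ρ • (ω : E))) ∂μ.toSphere
  have hi₂ : Integrable (fun ω : sphere (0 : E) 1 =>
      (boundarySpeed M' c' r' ρ (ω : E)).smulRight (ρ ^ n • F (ρ • (ω : E)))) μ.toSphere := by
    apply Continuous.integrable_sphere
    have h1 : Continuous fun ω : sphere (0 : E) 1 => boundarySpeed M' c' r' ρ (ω : E) :=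
      (continuous_boundarySpeed M' c' r' ρ).comp continuous_subtype_val
    have h2 : Continuous fun ω : sphere (0 : E) 1 => ρ ^ n • F (ρ • (ω : E)) :=
      (continuous_comp_sphere hρ hFcont).const_smul _
    exact ((ContinuousLinearMap.smulRightL ℝ X V).continuous.comp h1).clm_apply h2
  have hD₁a : ∀ Δ, D₁ Δ = ∫ x in closedBall 0 ρ, w x • fderiv ℝ g x (M' Δ x + c' Δ) ∂μ := by
    intro Δ
    rw [ContinuousLinearMap.integral_apply hi₁]
    rfl
  have hD₂a : ∀ Δ, D₂ Δ = ∫ ω : sphere (0 : E) 1, boundarySpeed M' c' r' ρ (ω : E) Δ •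
      (ρ ^ n • F (ρ • (ω : E))) ∂μ.toSphere := by
    intro Δ
    rw [ContinuousLinearMap.integral_apply hi₂]
    rfl
  refine ⟨D₁ + D₂, ?_, fun Δ => by rw [← hD₁a, ← hD₂a]; rfl⟩
  obtain ⟨L, hL, hLip⟩ := exists_eventually_norm_comp_sub_le hg hM hc hM₀ hc₀
    (by positivity : 0 < 4 * ρ)
  set d : X → E → ℝ := fun θ x =>
    (region M c r θ).indicator 1 x - (closedBall 0 ρ).indicator 1 x with hd
  have hballs : closedBall (0 : E) ρ ⊆ closedBall 0 (4 * ρ) :=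
    closedBall_subset_closedBall (by linarith)
  have hsub := eventually_region_subset hM.continuousAt hc.continuousAt hr.continuousAt hM₀ hc₀
    hr₀ hρ
  -- The change of the integral splits into three parts: the integrand changes over the fixed ball
  -- (`hO₁`), the region changes under the fixed integrand `F` (`hO₂`), and both change (`hO₃`). In
  -- the last, the integrand changes by `O(‖θ - θ₀‖)` times `|w|`, on a set whose `|w|`-mass tends
  -- to zero, so it is negligible.
  have hO₁ := hD₁.isLittleO
  have hO₂ : (fun θ => (∫ x, d θ x • F x ∂μ) - D₂ (θ - θ₀)) =o[𝓝 θ₀] fun θ => θ - θ₀ := by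
    simp only [hD₂a]
    exact isLittleO_integral_region μ hM hc hr hM₀ hc₀ hr₀ hρ hFm hFi hFcont
  have hO₃ : (fun θ => ∫ x, d θ x • (w x • (g (M θ x + c θ) - g x)) ∂μ)
      =o[𝓝 θ₀] fun θ => θ - θ₀ := by
    rw [Asymptotics.isLittleO_iff]
    intro κ hκ
    have hT := tendsto_integral_indicator_region_sub μ hM.continuousAt hc.continuousAt
      hr.continuousAt hM₀ hc₀ hr₀ hwi
    filter_upwards [hsub, hLip, hT.eventually (gt_mem_nhds (show 0 < κ / (L + 1) by positivity))]
      with θ hsub hLip hT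
    rw [lt_div_iff₀ (by positivity)] at hT
    have hint : Integrable (fun x => ‖d θ x‖ * ‖w x‖) μ := by
      have := (integrable_indicator_sub_smul (isClosed_region M c r θ).measurableSet
        measurableSet_closedBall hsub hballs hwi.integrableOn).norm
      simpa only [norm_smul] using this
    have hnn : 0 ≤ ∫ x, ‖d θ x‖ * ‖w x‖ ∂μ := integral_nonneg fun x => by positivity
    calc ‖∫ x, d θ x • (w x • (g (M θ x + c θ) - g x)) ∂μ‖
        ≤ ∫ x, ‖d θ x‖ * ‖w x‖ * (L * ‖θ - θ₀‖) ∂μ := by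
          refine norm_integral_le_of_norm_le (hint.mul_const _) (Eventually.of_forall fun x => ?_)
          rw [norm_smul, norm_smul, ← mul_assoc]
          by_cases hx : x ∈ closedBall (0 : E) (4 * ρ)
          · gcongr
            exact hLip x hx
          · have : d θ x = 0 := by
              simp only [hd, indicator_of_notMem (fun h => hx (hsub h)),
                indicator_of_notMem (fun h => hx (hballs h)), sub_self]
            simp [this]
      _ = (∫ x, ‖d θ x‖ * ‖w x‖ ∂μ) * L * ‖θ - θ₀‖ := by rw [integral_mul_const]; ring
      _ ≤ κ * ‖θ - θ₀‖ := by
          gcongr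
          linarith
  refine HasFDerivAt.of_isLittleO (((hO₁.add hO₂).add hO₃).congr' ?_ EventuallyEq.rfl)
  filter_upwards [hsub] with θ hsub
  have hA := (isClosed_region M c r θ).measurableSet
  have hGi : IntegrableOn (fun x => w x • g (M θ x + c θ)) (closedBall 0 (4 * ρ)) μ :=
    integrableOn_smul_continuous hwi (by fun_prop) (isCompact_closedBall _ _)
  have hdint : ∀ G : E → V, IntegrableOn G (closedBall 0 (4 * ρ)) μ →
      ∫ x, d θ x • G x ∂μ =
        (∫ x in region M c r θ, G x ∂μ) - ∫ x in closedBall 0 ρ, G x ∂μ := by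
    intro G hG
    rw [← integral_indicator hA, ← integral_indicator measurableSet_closedBall, ← integral_sub
      ((integrable_indicator_iff hA).2 (hG.mono_set hsub))
      ((integrable_indicator_iff measurableSet_closedBall).2 (hG.mono_set hballs))]
    congr 1 with x
    by_cases h1 : x ∈ region M c r θ <;> by_cases h2 : x ∈ closedBall (0 : E) ρ <;>
      simp [hd, h1, h2, -mem_closedBall]
  have h3 : ∫ x, d θ x • (w x • (g (M θ x + c θ) - g x)) ∂μ =
      (∫ x in region M c r θ, w x • g (M θ x + c θ) ∂μ) - (∫ x in region M c r θ, F x ∂μ) -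
        ((∫ x in closedBall 0 ρ, w x • g (M θ x + c θ) ∂μ) - ∫ x in closedBall 0 ρ, F x ∂μ) := by
    simp only [smul_sub]
    have := hdint (fun x => w x • g (M θ x + c θ) - F x) (hGi.sub hFi)
    simp only [hFdef, smul_sub] at this ⊢
    rw [this, integral_sub (hGi.mono_set hsub) (hFi.mono_set hsub),
      integral_sub (hGi.mono_set hballs) (hFi.mono_set hballs)]
  rw [h3, hdint F hFi, region_base hM₀ hc₀ hr₀, hM₀, hc₀]
  simp only [one_apply_eq_self, add_zero, add_apply]
  abel

end RegionDerivative

/-! ### Matrices acting on vectors, outer products, trace and determinant -/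

section MatrixAction

-- With the product structures removed, the topology and uniformity on matrices are the ones induced
-- by the entrywise norm.
attribute [-instance] instTopologicalSpaceMatrix Matrix.instUniformSpace

variable {k : ℕ}

theorem act_eq_toEuclideanCLM (A : Mat k) (x : Vec k) :
    act A x = Matrix.toEuclideanCLM (n := Fin k) (𝕜 := ℝ) A x := rfl

@[simp]
theorem act_add (A : Mat k) (x y : Vec k) : act A (x + y) = act A x + act A y := map_add _ x y

@[simp]
theorem act_sub (A : Mat k) (x y : Vec k) : act A (x - y) = act A x - act A y := map_sub _ x y

@[simp]
theorem act_smul (A : Mat k) (a : ℝ) (x : Vec k) : act A (a • x) = a • act A x := map_smul _ a x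

theorem act_add_left (A B : Mat k) (x : Vec k) : act (A + B) x = act A x + act B x := by
  simp [act]

theorem act_mul (A B : Mat k) (x : Vec k) : act (A * B) x = act A (act B x) := by
  simp [act_eq_toEuclideanCLM]

@[simp]
theorem act_one (x : Vec k) : act (1 : Mat k) x = x := by
  simp [act_eq_toEuclideanCLM]

theorem ofLp_act (A : Mat k) (x : Vec k) : (act A x).ofLp = A.mulVec x.ofLp := rfl

@[fun_prop]
theorem continuous_act (A : Mat k) : Continuous (act A) :=
  (Matrix.toEuclideanCLM (n := Fin k) (𝕜 := ℝ) A).continuous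

theorem inner_act_right (A : Mat k) (hA : A.IsSymm) (x y : Vec k) :
    inner ℝ x (act A y) = inner ℝ (act A x) y := by
  simp only [EuclideanSpace.inner_eq_star_dotProduct, ofLp_act, star_trivial]
  rw [Matrix.dotProduct_mulVec, ← Matrix.mulVec_transpose, hA.eq]

theorem outer_act (A : Mat k) (hA : A.IsSymm) (x : Vec k) : outer (act A x) = A * outer x * A := by
  simp only [outer, ofLp_act, Matrix.mul_vecMulVec, Matrix.vecMulVec_mul]
  rw [← Matrix.mulVec_transpose, hA.eq]

theorem trace_outer (x : Vec k) : (outer x).trace = ‖x‖ ^ 2 := by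
  rw [outer, Matrix.trace_vecMulVec, EuclideanSpace.norm_sq_eq]
  simp [dotProduct, sq]

@[fun_prop]
theorem continuous_outer : Continuous (outer : Vec k → Mat k) := by
  refine continuous_pi fun i => continuous_pi fun j => ?_
  simp only [outer, Matrix.vecMulVec_apply]
  fun_prop

theorem norm_outer_le (x : Vec k) : ‖outer x‖ ≤ ‖x‖ ^ 2 := by
  rw [Matrix.norm_le_iff (by positivity)]
  intro i j
  rw [outer, Matrix.vecMulVec_apply, norm_mul, sq]
  gcongr <;> exact PiLp.norm_apply_le x _

theorem isSymm_outer (x : Vec k) : (outer x).IsSymm := by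
  rw [Matrix.IsSymm, outer, Matrix.transpose_vecMulVec]

/-- The linear map `N ↦ A N A`. -/
noncomputable def conjugateBy (A : Mat k) : Mat k →L[ℝ] Mat k :=
  LinearMap.toContinuousLinearMap ((LinearMap.mulRight ℝ A).comp (LinearMap.mulLeft ℝ A))

@[simp]
theorem conjugateBy_apply (A N : Mat k) : conjugateBy A N = A * N * A := rfl

/-- The trace, as a continuous linear map. -/
noncomputable def traceCLM (k : ℕ) : Mat k →L[ℝ] ℝ :=
  LinearMap.toContinuousLinearMap (Matrix.traceLinearMap (Fin k) ℝ ℝ)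

@[simp]
theorem traceCLM_apply (N : Mat k) : traceCLM k N = N.trace := rfl

/-- A positive semidefinite matrix whose trace is at most its size has determinant at most one. -/
theorem _root_.Matrix.PosSemidef.det_le_one_of_trace_le {N : Mat k} (hN : N.PosSemidef)
    (htr : N.trace ≤ k) : N.det ≤ 1 := by
  have hH := hN.isHermitian
  have hdet := hH.det_eq_prod_eigenvalues
  have htrace := hH.trace_eq_sum_eigenvalues
  simp only [RCLike.ofReal_real_eq_id, id_eq] at hdet htrace
  rw [hdet]
  -- Each eigenvalue satisfies `x ≤ exp (x - 1)`; the product of these bounds is `exp (tr N - k)`.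
  calc ∏ i, hH.eigenvalues i ≤ ∏ i, Real.exp (hH.eigenvalues i - 1) := by
        refine Finset.prod_le_prod (fun i _ => hN.eigenvalues_nonneg i) fun i _ => ?_
        linarith [Real.add_one_le_exp (hH.eigenvalues i - 1)]
    _ = Real.exp (∑ i, (hH.eigenvalues i - 1)) := (Real.exp_sum _ _).symm
    _ ≤ 1 := by
        rw [Real.exp_le_one_iff, Finset.sum_sub_distrib, ← htrace]
        simpa using htr

end MatrixAction

/-! ### Moments of trimming functions -/

section Minimizer

attribute [-instance] instTopologicalSpaceMatrix Matrix.instUniformSpace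

open Metric Filter Topology

variable {k : ℕ}

theorem mem_ellipsoid_iff {μ : Vec k} {G : Mat k} (hG : G.IsSymm) {s : ℝ} (hs : 0 ≤ s) (x : Vec k) :
    x ∈ ellipsoid μ (G * G) s ↔ ‖act G⁻¹ (x - μ)‖ ≤ s := by
  have hG' : (G⁻¹).IsSymm := by rw [Matrix.IsSymm, Matrix.transpose_nonsing_inv, hG.eq]
  rw [ellipsoid, mem_ofPred_eq, Matrix.mul_inv_rev, act_mul, inner_act_right _ hG',
    real_inner_self_eq_norm_sq, sq_le_sq₀ (norm_nonneg _) hs]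

theorem isClosed_ellipsoid (μ : Vec k) (S : Mat k) (s : ℝ) : IsClosed (ellipsoid μ S s) := by
  unfold ellipsoid
  exact isClosed_le (by fun_prop) continuous_const

section Trimming

variable {P : Measure (Vec k)} {γ : ℝ} {φ : Vec k → ℝ}

theorem IsTrimming.integrable [IsFiniteMeasure P] (hφ : IsTrimming P γ φ) : Integrable φ P := by
  refine Integrable.of_bound hφ.measurable.aestronglyMeasurable 1 (Eventually.of_forall fun x => ?_)
  rw [Real.norm_eq_abs, abs_of_nonneg (hφ.mem_Icc x).1]
  exact (hφ.mem_Icc x).2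

/-- Functions of at most quadratic growth are integrable against a trimming function. -/
theorem IsTrimming.integrable_smul [IsFiniteMeasure P] (hφ : IsTrimming P γ φ) {V : Type*}
    [NormedAddCommGroup V] [NormedSpace ℝ V] {h : Vec k → V} (hh : Continuous h) (a b : ℝ)
    (hb : ∀ x, ‖h x‖ ≤ a * ‖x‖ ^ 2 + b) : Integrable (fun x => φ x • h x) P := by
  refine Integrable.mono' ((hφ.moment.const_mul a).add (hφ.integrable.const_mul b))
    (hφ.measurable.aestronglyMeasurable.smul hh.aestronglyMeasurable) (Eventually.of_forall ?_)
  intro x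
  have h0 := (hφ.mem_Icc x).1
  rw [norm_smul, Real.norm_eq_abs, abs_of_nonneg h0]
  calc φ x * ‖h x‖ ≤ φ x * (a * ‖x‖ ^ 2 + b) := by gcongr; exact hb x
    _ = a * (‖x‖ ^ 2 * φ x) + b * φ x := by ring

theorem norm_sub_sq_le (x m : Vec k) : ‖x - m‖ ^ 2 ≤ 2 * ‖x‖ ^ 2 + 2 * ‖m‖ ^ 2 := by
  have h1 : ‖x - m‖ ≤ ‖x‖ + ‖m‖ := norm_sub_le _ _
  have h2 : ‖x - m‖ ^ 2 ≤ (‖x‖ + ‖m‖) ^ 2 := by gcongr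
  nlinarith [sq_nonneg (‖x‖ - ‖m‖)]

theorem IsTrimming.integrable_smul_id [IsFiniteMeasure P] (hφ : IsTrimming P γ φ) :
    Integrable (fun x => φ x • x) P :=
  hφ.integrable_smul continuous_id 1 1 fun x => by
    nlinarith [sq_nonneg (‖x‖ - 1), sq_nonneg ‖x‖, norm_nonneg x, show ‖id x‖ = ‖x‖ from rfl]

theorem IsTrimming.integrable_smul_outer [IsFiniteMeasure P] (hφ : IsTrimming P γ φ) (m : Vec k) :
    Integrable (fun x => φ x • outer (x - m)) P :=
  hφ.integrable_smul (by fun_prop) 2 (2 * ‖m‖ ^ 2) fun x =>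
    (norm_outer_le _).trans (norm_sub_sq_le x m)

theorem IsTrimming.integrable_smul_norm_sq [IsFiniteMeasure P] (hφ : IsTrimming P γ φ)
    (A : Mat k) (m : Vec k) : Integrable (fun x => φ x * ‖act A (x - m)‖ ^ 2) P := by
  obtain ⟨C, hC, hA⟩ : ∃ C : ℝ, 0 ≤ C ∧ ∀ x, ‖act A x‖ ≤ C * ‖x‖ :=
    ⟨_, norm_nonneg _, fun x => (Matrix.toEuclideanCLM (n := Fin k) (𝕜 := ℝ) A).le_opNorm x⟩
  refine hφ.integrable_smul (by fun_prop) (C ^ 2 * 2) (C ^ 2 * (2 * ‖m‖ ^ 2)) fun x => ?_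
  rw [Real.norm_eq_abs, abs_of_nonneg (by positivity)]
  calc ‖act A (x - m)‖ ^ 2 ≤ (C * ‖x - m‖) ^ 2 := by gcongr; exact hA _
    _ = C ^ 2 * ‖x - m‖ ^ 2 := by ring
    _ ≤ C ^ 2 * (2 * ‖x‖ ^ 2 + 2 * ‖m‖ ^ 2) := by gcongr; exact norm_sub_sq_le x m
    _ = _ := by ring

theorem IsTrimming.integral_smul_eq (hγ : 0 < γ) (hφ : IsTrimming P γ φ) :
    ∫ x, φ x • x ∂P = (∫ x, φ x ∂P) • trimMean P φ := by
  rw [trimMean, smul_smul, mul_inv_cancel₀ (hγ.trans_le hφ.mass).ne', one_smul]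

theorem IsTrimming.integral_smul_outer_eq (hγ : 0 < γ) (hφ : IsTrimming P γ φ) :
    ∫ x, φ x • outer (x - trimMean P φ) ∂P = (∫ x, φ x ∂P) • trimCov P φ := by
  rw [trimCov, smul_smul, mul_inv_cancel₀ (hγ.trans_le hφ.mass).ne', one_smul]

/-- The standardized trimmed covariance matrix is an integral over standardized observations. -/
theorem IsTrimming.integral_smul_outer_act_eq [IsFiniteMeasure P] (hγ : 0 < γ)
    (hφ : IsTrimming P γ φ) {A : Mat k} (hA : A.IsSymm) :
    ∫ x, φ x • outer (act A (x - trimMean P φ)) ∂P =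
      (∫ x, φ x ∂P) • (A * trimCov P φ * A) := by
  have h := (conjugateBy A).integral_comp_comm (hφ.integrable_smul_outer (trimMean P φ))
  rw [hφ.integral_smul_outer_eq hγ, map_smul, conjugateBy_apply] at h
  rw [← h]
  congr 1 with x : 1
  rw [map_smul, conjugateBy_apply, outer_act A hA]

theorem IsTrimming.integral_smul_norm_sq_eq [IsFiniteMeasure P] (hγ : 0 < γ)
    (hφ : IsTrimming P γ φ) {A : Mat k} (hA : A.IsSymm) :
    ∫ x, φ x * ‖act A (x - trimMean P φ)‖ ^ 2 ∂P =
      (∫ x, φ x ∂P) * (A * trimCov P φ * A).trace := by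
  have hi : Integrable (fun x => φ x • outer (act A (x - trimMean P φ))) P := by
    have h := (conjugateBy A).integrable_comp (hφ.integrable_smul_outer (trimMean P φ))
    refine h.congr (Eventually.of_forall fun x => ?_)
    simp only [map_smul, conjugateBy_apply, outer_act A hA]
  have h := (traceCLM k).integral_comp_comm hi
  rw [hφ.integral_smul_outer_act_eq hγ hA, map_smul, traceCLM_apply, smul_eq_mul] at h
  rw [← h]
  congr 1 with x : 1
  rw [map_smul, traceCLM_apply, trace_outer, smul_eq_mul]

/-- The quadratic deviation from the trimmed mean is at most that from any other point. -/
theorem IsTrimming.integral_norm_sq_le [IsFiniteMeasure P] (hγ : 0 < γ)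
    (hφ : IsTrimming P γ φ) (A : Mat k) (m : Vec k) :
    ∫ x, φ x * ‖act A (x - trimMean P φ)‖ ^ 2 ∂P ≤ ∫ x, φ x * ‖act A (x - m)‖ ^ 2 ∂P := by
  set T := trimMean P φ with hT
  set v := act A (T - m) with hv
  set L : Vec k →L[ℝ] ℝ :=
    (innerSL ℝ v).comp (Matrix.toEuclideanCLM (n := Fin k) (𝕜 := ℝ) A) with hL
  have hLx : ∀ x, L x = inner ℝ v (act A x) := fun x => rfl
  have hi := hφ.integrable_smul_id
  have h1 := L.integral_comp_comm hi
  rw [hφ.integral_smul_eq hγ, ← hT, map_smul, smul_eq_mul] at h1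
  simp only [map_smul, smul_eq_mul] at h1
  have hiL : Integrable (fun x => φ x * L x) P := by
    have := L.integrable_comp hi
    simpa only [map_smul, smul_eq_mul] using this
  -- Expansion of the square about the trimmed mean `T`. The part linear in `x - T` integrates to
  -- zero, which leaves `(∫ φ) ‖v‖²`.
  have h2 : ∀ x, φ x * ‖act A (x - m)‖ ^ 2 - φ x * ‖act A (x - T)‖ ^ 2 =
      2 * (φ x * L x) + (‖v‖ ^ 2 - 2 * L T) * φ x := by
    intro x
    have e : act A (x - m) = act A (x - T) + v := by rw [hv, ← act_add]; congr 1; abel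
    rw [e, norm_add_sq_real, hLx, hLx, real_inner_comm, act_sub A x T, inner_sub_right]
    ring
  have h3 : (∫ x, φ x * ‖act A (x - m)‖ ^ 2 ∂P) - ∫ x, φ x * ‖act A (x - T)‖ ^ 2 ∂P =
      (∫ x, φ x ∂P) * ‖v‖ ^ 2 := by
    rw [← integral_sub (hφ.integrable_smul_norm_sq A m) (hφ.integrable_smul_norm_sq A T)]
    simp only [h2]
    rw [integral_add (hiL.const_mul 2) (hφ.integrable.const_mul _), integral_const_mul,
      integral_const_mul, h1]
    ring
  have h4 : 0 ≤ (∫ x, φ x ∂P) * ‖v‖ ^ 2 :=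
    mul_nonneg (hγ.le.trans hφ.mass) (sq_nonneg _)
  linarith

/-- Transposition and `N ↦ v' N v` are continuous and linear, hence commute with the integral, and
they reduce the claim to `(v' x)² ≥ 0` for a single outer product. -/
theorem IsTrimming.posSemidef_trimCov [IsFiniteMeasure P] (hγ : 0 < γ) (hφ : IsTrimming P γ φ) :
    (trimCov P φ).PosSemidef := by
  have hc : 0 < ∫ x, φ x ∂P := hγ.trans_le hφ.mass
  refine Matrix.PosSemidef.smul ?_ (inv_nonneg.2 hc.le)
  have hi := hφ.integrable_smul_outer (trimMean P φ)
  have hsymm : (∫ x, φ x • outer (x - trimMean P φ) ∂P).IsSymm := by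
    set τ : Mat k →L[ℝ] Mat k := LinearMap.toContinuousLinearMap
      (Matrix.transposeLinearEquiv (Fin k) (Fin k) ℝ ℝ).toLinearMap
    have h := τ.integral_comp_comm hi
    have hτ : ∀ N : Mat k, τ N = N.transpose := fun N => rfl
    rw [Matrix.IsSymm, ← hτ, ← h]
    congr 1 with x : 1
    rw [map_smul, hτ, (isSymm_outer _).eq]
  refine Matrix.PosSemidef.of_dotProduct_mulVec_nonneg ?_ fun v => ?_
  · rw [Matrix.IsHermitian, Matrix.conjTranspose_eq_transpose_of_trivial, hsymm.eq]
  · set q : Mat k →L[ℝ] ℝ := LinearMap.toContinuousLinearMap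
      ((LinearMap.mk ⟨fun N : Mat k => star v ⬝ᵥ N.mulVec v, fun N N' => by
        simp [Matrix.add_mulVec]⟩ fun a N => by simp [Matrix.smul_mulVec]) : Mat k →ₗ[ℝ] ℝ)
    have hq : ∀ N : Mat k, q N = star v ⬝ᵥ N.mulVec v := fun N => rfl
    rw [← hq, ← q.integral_comp_comm hi]
    refine integral_nonneg fun x => ?_
    change 0 ≤ q (φ x • outer (x - trimMean P φ))
    rw [map_smul, hq, outer, Matrix.vecMulVec_mulVec, star_trivial, smul_eq_mul]
    refine mul_nonneg (hφ.mem_Icc x).1 ?_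
    rw [dotProduct_smul, op_smul_eq_smul, smul_eq_mul, dotProduct_comm v]
    exact mul_self_nonneg _

end Trimming

end Minimizer

/-! ### The indicator of the MCD ellipsoid is a minimizer -/

section TrimmingEllipsoid

attribute [-instance] instTopologicalSpaceMatrix Matrix.instUniformSpace

open Metric Filter Topology

variable {k : ℕ}

/-- If a law on the line has no atom at the infimum of the positive `s` with mass at least `γ` on
`(-∞, s]`, and gives no mass to `(-∞, 0]`, then this infimum is an exact `γ`-quantile. -/
theorem quantile_of_isGLB {ν : Measure ℝ} [IsProbabilityMeasure ν] {γ ρ : ℝ} (hγ : 0 < γ)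
    (hρ : IsGLB {s : ℝ | 0 < s ∧ γ ≤ ν.real (Iic s)} ρ) (h0 : ν.real (Iic 0) = 0)
    (hatom : ν {ρ} = 0) : 0 < ρ ∧ ν.real (Iic ρ) = γ := by
  set F := ProbabilityTheory.cdf ν with hF
  have hFν : ∀ s, F s = ν.real (Iic s) := ProbabilityTheory.cdf_eq_real ν
  have hρ0 : 0 ≤ ρ := hρ.2 fun s hs => hs.1.le
  have hge : γ ≤ F ρ := by
    -- Every `s > ρ` exceeds an element of the set, so `F s ≥ γ`; right continuity carries this to
    -- `ρ`.
    have hrc : Tendsto F (𝓝[>] ρ) (𝓝 (F ρ)) :=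
      (F.right_continuous ρ).tendsto.mono_left (nhdsWithin_mono _ Ioi_subset_Ici_self)
    refine ge_of_tendsto hrc ?_
    filter_upwards [self_mem_nhdsWithin] with s hs
    obtain ⟨s', hs', -, hlt⟩ := hρ.exists_between hs
    have h1 : γ ≤ F s' := by rw [hFν]; exact hs'.2
    exact h1.trans (F.mono hlt.le)
  have hpos : 0 < ρ := by
    rcases hρ0.lt_or_eq with h | h
    · exact h
    · rw [← h, hFν, h0] at hge; linarith
  refine ⟨hpos, le_antisymm ?_ (by rw [← hFν]; exact hge)⟩
  -- Without an atom at `ρ`, the value `F ρ` is the limit from the left, where `F s < γ` for `0 < s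
  -- < ρ` because `ρ` is a lower bound.
  have hleft : F ρ = Function.leftLim F ρ := by
    have h1 : F.measure {ρ} = 0 := by rw [hF, ProbabilityTheory.measure_cdf, hatom]
    rw [StieltjesFunction.measure_singleton, ENNReal.ofReal_eq_zero] at h1
    exact le_antisymm (by linarith) (F.mono.leftLim_le le_rfl)
  rw [← hFν, hleft]
  refine le_of_tendsto (F.mono.tendsto_leftLim ρ) ?_
  filter_upwards [Ioo_mem_nhdsLT hpos] with s hs
  by_contra! h
  have : ρ ≤ s := hρ.1 ⟨hs.1, by rw [← hFν]; exact h.le⟩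
  linarith [hs.2]

variable {P : Measure (Vec k)} {γ : ℝ} {φ : Vec k → ℝ}

theorem isTrimming_indicator_ellipsoid [IsFiniteMeasure P] {m : Vec k} {G : Mat k}
    (hG : G.IsSymm) (hGu : IsUnit G.det) {ρ : ℝ} (hρ : 0 ≤ ρ)
    (hmass : P.real (ellipsoid m (G * G) ρ) = γ) :
    IsTrimming P γ ((ellipsoid m (G * G) ρ).indicator 1) := by
  have hmeas := (isClosed_ellipsoid m (G * G) ρ).measurableSet
  have h01 : ∀ x, (ellipsoid m (G * G) ρ).indicator (1 : Vec k → ℝ) x ∈ Icc (0 : ℝ) 1 := by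
    intro x
    by_cases h : x ∈ ellipsoid m (G * G) ρ <;> simp [h]
  refine ⟨measurable_one.indicator hmeas, h01, ?_, ?_⟩
  · rw [integral_indicator_one hmeas, hmass]
  · set C := ‖Matrix.toEuclideanCLM (n := Fin k) (𝕜 := ℝ) G‖ * ρ + ‖m‖
    refine Integrable.of_bound (C := C ^ 2) ?_ (Eventually.of_forall fun x => ?_)
    · exact (Measurable.mul (by fun_prop) (measurable_one.indicator hmeas)).aestronglyMeasurable
    · by_cases h : x ∈ ellipsoid m (G * G) ρ
      · rw [indicator_of_mem h, Pi.one_apply, mul_one, norm_pow, norm_norm]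
        have hx : x = act G (act G⁻¹ (x - m)) + m := by
          rw [← act_mul, Matrix.mul_nonsing_inv _ hGu, act_one]; abel
        have hxC : ‖x‖ ≤ C := by
          conv_lhs => rw [hx]
          refine (norm_add_le _ _).trans ?_
          simp only [C]
          gcongr
          refine ((Matrix.toEuclideanCLM (n := Fin k) (𝕜 := ℝ) G).le_opNorm _).trans ?_
          gcongr
          exact (mem_ellipsoid_iff hG hρ x).1 h
        gcongr
      · rw [indicator_of_notMem h, mul_zero, norm_zero]
        positivity

/-- The ellipsoid determined by a trimming function `φ` has the smallest quadratic deviation. -/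
theorem integral_indicator_ellipsoid_norm_sq_le [IsFiniteMeasure P] (hγ : 0 < γ)
    (hφ : IsTrimming P γ φ) {G : Mat k} (hG : G.IsSymm) (hGu : IsUnit G.det)
    (hcov : G * G = trimCov P φ) {ρ : ℝ} (hρ : 0 ≤ ρ)
    (hmass : P.real (ellipsoid (trimMean P φ) (G * G) ρ) = γ) :
    ∫ x, (ellipsoid (trimMean P φ) (G * G) ρ).indicator 1 x * ‖act G⁻¹ (x - trimMean P φ)‖ ^ 2 ∂P
      ≤ γ * k := by
  set m := trimMean P φ
  set E := ellipsoid m (G * G) ρ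
  have hG' : (G⁻¹).IsSymm := by rw [Matrix.IsSymm, Matrix.transpose_nonsing_inv, hG.eq]
  have hψ := isTrimming_indicator_ellipsoid hG hGu hρ hmass
  set ψ : Vec k → ℝ := E.indicator 1
  set c := ∫ x, φ x ∂P with hc
  have hcpos : 0 < c := hγ.trans_le hφ.mass
  have hψmass : ∫ x, ψ x ∂P = γ := by
    rw [integral_indicator_one (isClosed_ellipsoid _ _ _).measurableSet, hmass]
  have htr : (G⁻¹ * trimCov P φ * G⁻¹).trace = k := by
    rw [← hcov, ← Matrix.mul_assoc, Matrix.nonsing_inv_mul _ hGu, Matrix.one_mul,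
      Matrix.mul_nonsing_inv _ hGu, Matrix.trace_one, Fintype.card_fin]
  have hφint : ∫ x, φ x * ‖act G⁻¹ (x - m)‖ ^ 2 ∂P = c * k := by
    rw [hφ.integral_smul_norm_sq_eq hγ hG', htr]
  set q : Vec k → ℝ := fun x => ‖act G⁻¹ (x - m)‖ ^ 2 with hq
  -- Bathtub principle: `(q - ρ²) (γ/c φ - ψ) ≥ 0`, since `ψ` is 1 where `q ≤ ρ²` and 0 elsewhere,
  -- and `0 ≤ γ/c φ ≤ 1`. The factor `γ/c` gives both functions mass `γ`, so the `ρ²` terms cancel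
  -- on integration.
  have hpt : ∀ x, 0 ≤ γ / c * (φ x * q x) - ρ ^ 2 * (γ / c) * φ x - ψ x * q x + ρ ^ 2 * ψ x := by
    intro x
    have hφ01 := hφ.mem_Icc x
    have hγc : γ / c ≤ 1 := (div_le_one hcpos).2 hφ.mass
    have hγc0 : 0 ≤ γ / c := by positivity
    have e : γ / c * (φ x * q x) - ρ ^ 2 * (γ / c) * φ x - ψ x * q x + ρ ^ 2 * ψ x =
      (q x - ρ ^ 2) * (γ / c * φ x - ψ x) := by ring
    rw [e]
    by_cases h : x ∈ E
    · have h1 : q x ≤ ρ ^ 2 := by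
        have := (mem_ellipsoid_iff hG hρ x).1 h
        simp only [hq]; gcongr
      have h2 : ψ x = 1 := by simp only [ψ, indicator_of_mem h, Pi.one_apply]
      have h3 : γ / c * φ x ≤ 1 := mul_le_one₀ hγc hφ01.1 hφ01.2
      rw [h2]
      exact mul_nonneg_of_nonpos_of_nonpos (by linarith) (by linarith)
    · have h1 : ρ ^ 2 ≤ q x := by
        have : ρ < ‖act G⁻¹ (x - m)‖ := by
          by_contra! h'; exact h ((mem_ellipsoid_iff hG hρ x).2 h')
        simp only [hq]; gcongr
      have h2 : ψ x = 0 := by simp only [ψ, indicator_of_notMem h]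
      rw [h2, sub_zero]
      exact mul_nonneg (by linarith) (mul_nonneg hγc0 hφ01.1)
  have hi1 : Integrable (fun x => γ / c * (φ x * q x)) P :=
    (hφ.integrable_smul_norm_sq G⁻¹ m).const_mul (γ / c)
  have hi2 : Integrable (fun x => ρ ^ 2 * (γ / c) * φ x) P := hφ.integrable.const_mul _
  have hi3 : Integrable (fun x => ψ x * q x) P := hψ.integrable_smul_norm_sq G⁻¹ m
  have hi4 : Integrable (fun x => ρ ^ 2 * ψ x) P := hψ.integrable.const_mul _
  have hi12 : Integrable (fun x => γ / c * (φ x * q x) - ρ ^ 2 * (γ / c) * φ x) P := hi1.sub hi2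
  have hi123 : Integrable (fun x => γ / c * (φ x * q x) - ρ ^ 2 * (γ / c) * φ x - ψ x * q x) P :=
    hi12.sub hi3
  have hint : 0 ≤ ∫ x, (γ / c * (φ x * q x) - ρ ^ 2 * (γ / c) * φ x - ψ x * q x
      + ρ ^ 2 * ψ x) ∂P := integral_nonneg hpt
  rw [integral_add hi123 hi4, integral_sub hi12 hi3,
    integral_sub hi1 hi2, integral_const_mul, integral_const_mul, integral_const_mul, hφint,
    hψmass, ← hc] at hint
  have e1 : γ / c * (c * k) = γ * k := by field_simp
  have e2 : ρ ^ 2 * (γ / c) * c = ρ ^ 2 * γ := by field_simp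
  rw [e1, e2] at hint
  linarith

/-- If `φ` minimizes the determinant of the trimmed covariance matrix, so does the indicator
function of the ellipsoid determined by `φ`. -/
theorem IsMinimizer.indicator_ellipsoid [IsFiniteMeasure P] (hγ : 0 < γ)
    (hφ : IsMinimizer P γ φ) {G : Mat k} (hG : G.PosDef)
    (hcov : G * G = trimCov P φ) {ρ : ℝ} (hρ : 0 ≤ ρ)
    (hmass : P.real (ellipsoid (trimMean P φ) (G * G) ρ) = γ) :
    IsMinimizer P γ ((ellipsoid (trimMean P φ) (G * G) ρ).indicator 1) := by
  have hGs : G.IsSymm := by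
    have := hG.isHermitian
    rwa [Matrix.IsHermitian, Matrix.conjTranspose_eq_transpose_of_trivial] at this
  have hGu : IsUnit G.det := hG.det_pos.ne'.isUnit
  have hG' : (G⁻¹).IsSymm := by rw [Matrix.IsSymm, Matrix.transpose_nonsing_inv, hGs.eq]
  have hψ := isTrimming_indicator_ellipsoid hGs hGu hρ hmass
  refine ⟨hψ, fun ψ' hψ' => le_trans ?_ (hφ.2 ψ' hψ')⟩
  set ψ : Vec k → ℝ := (ellipsoid (trimMean P φ) (G * G) ρ).indicator 1
  have hψmass : ∫ x, ψ x ∂P = γ := by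
    rw [integral_indicator_one (isClosed_ellipsoid _ _ _).measurableSet, hmass]
  -- `γ` times this trace is the deviation of `ψ` about its own mean. That is at most its deviation
  -- about the mean of `φ`, which is at most `γ k`.
  have htr : (G⁻¹ * trimCov P ψ * G⁻¹).trace ≤ k := by
    have h1 := hψ.integral_smul_norm_sq_eq hγ hG'
    have h2 := hψ.integral_norm_sq_le hγ G⁻¹ (trimMean P φ)
    have h3 := integral_indicator_ellipsoid_norm_sq_le hγ hφ.1 hGs hGu hcov hρ hmass
    rw [h1, hψmass] at h2
    exact le_of_mul_le_mul_left (h2.trans h3) hγ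
  have hpsd : (G⁻¹ * trimCov P ψ * G⁻¹).PosSemidef := by
    have := (hψ.posSemidef_trimCov hγ).conjTranspose_mul_mul_same G⁻¹
    rwa [Matrix.conjTranspose_eq_transpose_of_trivial, hG'.eq] at this
  have hdet := hpsd.det_le_one_of_trace_le htr
  have hdetpos := hG.det_pos
  rw [Matrix.det_mul, Matrix.det_mul, Matrix.det_nonsing_inv, Ring.inverse_eq_inv'] at hdet
  rw [← hcov, Matrix.det_mul]
  have e : (G.det)⁻¹ * (trimCov P ψ).det * (G.det)⁻¹ =
      (trimCov P ψ).det / (G.det * G.det) := by field_simp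
  rwa [e, div_le_one (by positivity)] at hdet

end TrimmingEllipsoid

/-! ### Change of variables and the moments of the standardized density -/

section StandardizedDensity

attribute [-instance] instTopologicalSpaceMatrix Matrix.instUniformSpace

open Metric Filter Topology

variable {k : ℕ}

theorem det_toEuclideanCLM (G : Mat k) :
    (Matrix.toEuclideanCLM (n := Fin k) (𝕜 := ℝ) G).det = G.det := by
  have : ((Matrix.toEuclideanCLM (n := Fin k) (𝕜 := ℝ) G : Vec k →L[ℝ] Vec k) : Vec k →ₗ[ℝ] Vec k)
      = Matrix.toLin (PiLp.basisFun 2 ℝ (Fin k)) (PiLp.basisFun 2 ℝ (Fin k)) G := by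
    rw [← Matrix.toLpLin_eq_toLin]; rfl
  rw [ContinuousLinearMap.det, this, LinearMap.det_toLin]

/-- The density of `G⁻¹ (Y - m)`, if `Y` has density `f` and `G` has positive determinant. -/
noncomputable def standardizedDensity (f : Vec k → ℝ) (m : Vec k) (G : Mat k) (x : Vec k) : ℝ :=
  G.det * f (act G x + m)

section

variable {f : Vec k → ℝ} {P : Measure (Vec k)} {m : Vec k} {G : Mat k}

theorem hasFDerivAt_act_add (G : Mat k) (m x : Vec k) :
    HasFDerivAt (fun x => act G x + m) (Matrix.toEuclideanCLM (n := Fin k) (𝕜 := ℝ) G) x :=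
  (Matrix.toEuclideanCLM (n := Fin k) (𝕜 := ℝ) G).hasFDerivAt.add_const m

theorem act_inv_act (hG : IsUnit G.det) (x : Vec k) : act G⁻¹ (act G x) = x := by
  rw [← act_mul, Matrix.nonsing_inv_mul _ hG, act_one]

theorem act_act_inv (hG : IsUnit G.det) (x : Vec k) : act G (act G⁻¹ x) = x := by
  rw [← act_mul, Matrix.mul_nonsing_inv _ hG, act_one]

theorem injective_act_add (hG : IsUnit G.det) : Function.Injective fun x => act G x + m := by
  intro x y h
  rw [← act_inv_act hG x, ← act_inv_act hG y, add_right_cancel h]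

theorem image_act_add_univ (hG : IsUnit G.det) : (fun x => act G x + m) '' univ = univ := by
  rw [image_univ]
  refine range_eq_univ.2 fun y => ⟨act G⁻¹ (y - m), ?_⟩
  simp only [act_act_inv hG]; abel

theorem measurable_standardizedDensity (hf : IsDensity P f) (m : Vec k) (G : Mat k) :
    Measurable (standardizedDensity f m G) := by
  have := hf.measurable
  unfold standardizedDensity
  fun_prop

theorem standardizedDensity_nonneg (hf : IsDensity P f) (hG : 0 < G.det) (x : Vec k) :
    0 ≤ standardizedDensity f m G x := mul_nonneg hG.le (hf.nonneg _)

theorem IsDensity.integrable [IsFiniteMeasure P] (hf : IsDensity P f) : Integrable f := by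
  refine ⟨hf.measurable.aestronglyMeasurable, ?_⟩
  rw [hasFiniteIntegral_iff_ofReal (Eventually.of_forall hf.nonneg)]
  have := measure_lt_top P univ
  rwa [hf.eq_withDensity, withDensity_apply _ MeasurableSet.univ, setLIntegral_univ] at this

theorem integrable_standardizedDensity [IsFiniteMeasure P] (hf : IsDensity P f) (m : Vec k)
    (hG : 0 < G.det) : Integrable (standardizedDensity f m G) := by
  have h := (integrableOn_image_iff_integrableOn_abs_det_fderiv_smul volume MeasurableSet.univ
    (fun x _ => (hasFDerivAt_act_add G m x).hasFDerivWithinAt)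
    (injective_act_add hG.ne'.isUnit).injOn f).1 hf.integrable.integrableOn
  rw [integrableOn_univ] at h
  simpa only [det_toEuclideanCLM, abs_of_pos hG, smul_eq_mul] using! h

variable {V : Type*} [NormedAddCommGroup V] [NormedSpace ℝ V]

/-- Change of variables to standardized observations. -/
theorem IsDensity.integral_eq (hf : IsDensity P f) (m : Vec k) (hG : 0 < G.det) (h : Vec k → V) :
    ∫ y, h y ∂P = ∫ x, standardizedDensity f m G x • h (act G x + m) := by
  have h1 : ∫ y, h y ∂P = ∫ y, f y • h y := by
    rw [hf.eq_withDensity, integral_withDensity_eq_integral_toReal_smul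
      hf.measurable.ennreal_ofReal (Eventually.of_forall fun _ => ENNReal.ofReal_lt_top)]
    simp only [ENNReal.toReal_ofReal (hf.nonneg _)]
  have h2 := integral_image_eq_integral_abs_det_fderiv_smul volume MeasurableSet.univ
    (fun x _ => (hasFDerivAt_act_add G m x).hasFDerivWithinAt)
    (injective_act_add hG.ne'.isUnit).injOn (fun y => f y • h y)
  rw [image_act_add_univ hG.ne'.isUnit, setIntegral_univ, setIntegral_univ] at h2
  rw [h1, h2]
  simp only [det_toEuclideanCLM, abs_of_pos hG, smul_smul, standardizedDensity]

theorem IsDensity.setIntegral_eq (hf : IsDensity P f) (m : Vec k) (hG : 0 < G.det) {S : Set (Vec k)}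
    (hS : MeasurableSet S) (h : Vec k → V) :
    ∫ y in S, h y ∂P =
      ∫ x in (fun x => act G x + m) ⁻¹' S, standardizedDensity f m G x • h (act G x + m) := by
  rw [← integral_indicator hS, hf.integral_eq m hG,
    ← integral_indicator (hS.preimage (by fun_prop))]
  congr 1 with x
  by_cases hx : act G x + m ∈ S
  · rw [indicator_of_mem hx, indicator_of_mem (show x ∈ (fun x => act G x + m) ⁻¹' S from hx)]
  · rw [indicator_of_notMem hx, smul_zero,
      indicator_of_notMem (show x ∉ (fun x => act G x + m) ⁻¹' S from hx)]

theorem IsDensity.measureReal_eq (hf : IsDensity P f) (m : Vec k) (hG : 0 < G.det)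
    {S : Set (Vec k)} (hS : MeasurableSet S) :
    P.real S = ∫ x in (fun x => act G x + m) ⁻¹' S, standardizedDensity f m G x := by
  have := hf.setIntegral_eq m hG hS fun _ => (1 : ℝ)
  simpa using this

end

/-- The moments of the standardized observations in the ball that corresponds to the MCD ellipsoid.
-/
structure StandardizedMoments (γ : ℝ) (w : Vec k → ℝ) (ρ : ℝ) : Prop where
  pos : 0 < ρ
  mass : ∫ x in closedBall 0 ρ, w x = γ
  mean : ∫ x in closedBall 0 ρ, w x • x = 0
  cov : ∫ x in closedBall 0 ρ, w x • outer x = γ • (1 : Mat k)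

theorem preimage_ellipsoid {m : Vec k} {G : Mat k} (hG : G.IsSymm) (hGu : IsUnit G.det) {ρ : ℝ}
    (hρ : 0 ≤ ρ) : (fun x => act G x + m) ⁻¹' ellipsoid m (G * G) ρ = closedBall 0 ρ := by
  ext x
  rw [mem_preimage, mem_ellipsoid_iff hG hρ, add_sub_cancel_right, act_inv_act hGu,
    mem_closedBall_zero_iff]

/-- The MCD radius is positive, and the MCD ellipsoid has mass `γ`. -/
theorem IsTrimRadius.pos_and_mass [NeZero k] {P : Measure (Vec k)} [IsProbabilityMeasure P]
    {f : Vec k → ℝ}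
    (hf : IsDensity P f) {γ : ℝ} (hγ : 0 < γ) {φ : Vec k → ℝ} {ρ : ℝ} (hρ : IsTrimRadius P γ φ ρ)
    {G : Mat k} (hG : G.IsSymm) (hGd : 0 < G.det) (hcov : G * G = trimCov P φ) :
    0 < ρ ∧ P.real (ellipsoid (trimMean P φ) (G * G) ρ) = γ := by
  set m := trimMean P φ with hm
  have hGu := hGd.ne'.isUnit
  -- The radius is a quantile of the law of `z` under `P`. This law has no mass on `(-∞, 0]` and no
  -- atom at `ρ`, because in standardized coordinates the preimages are a point and a sphere, both
  -- Lebesgue null.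
  set z : Vec k → ℝ := fun y => ‖act G⁻¹ (y - m)‖ with hz
  have hzm : Measurable z := (by fun_prop : Continuous z).measurable
  set ν := P.map z with hν
  have : IsProbabilityMeasure ν := Measure.isProbabilityMeasure_map hzm.aemeasurable
  have hνreal : ∀ S : Set ℝ, MeasurableSet S → ν.real S = P.real (z ⁻¹' S) := fun S hS =>
    map_measureReal_apply hzm hS
  have hpre : ∀ S : Set ℝ, (fun x => act G x + m) ⁻¹' (z ⁻¹' S) = norm ⁻¹' S := by
    intro S
    ext x
    simp only [mem_preimage, hz, add_sub_cancel_right, act_inv_act hGu]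
  have hzero : ∀ S : Set ℝ, MeasurableSet S → volume (norm ⁻¹' S : Set (Vec k)) = 0 →
      ν.real S = 0 := by
    intro S hS h0
    rw [hνreal S hS, hf.measureReal_eq m hGd (hS.preimage hzm), hpre,
      Measure.restrict_eq_zero.2 h0, integral_zero_measure]
  have hell : ∀ s, 0 ≤ s → ν.real (Iic s) = P.real (ellipsoid m (G * G) s) := by
    intro s hs
    rw [hνreal _ measurableSet_Iic]
    congr 1 with y
    rw [mem_ellipsoid_iff hG hs]
    rfl
  have hGLB : IsGLB {s : ℝ | 0 < s ∧ γ ≤ ν.real (Iic s)} ρ := by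
    have : {s : ℝ | 0 < s ∧ γ ≤ ν.real (Iic s)} =
        {s : ℝ | 0 < s ∧ γ ≤ P.real (ellipsoid (trimMean P φ) (trimCov P φ) s)} := by
      ext s
      simp only [mem_ofPred_eq, ← hcov]
      exact and_congr_right fun hs => by rw [hell s hs.le]
    rw [this]
    exact hρ
  have hq := quantile_of_isGLB hγ hGLB
    (hzero _ measurableSet_Iic (by
      have : (norm ⁻¹' Iic 0 : Set (Vec k)) = {0} := by ext x; simp
      rw [this]; exact measure_singleton _))
    (by
      have h1 := hzero {ρ} (measurableSet_singleton _) (by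
        have : (norm ⁻¹' {ρ} : Set (Vec k)) = sphere 0 ρ := by ext x; simp
        rw [this]; exact Measure.addHaar_sphere _ _ _)
      rwa [measureReal_eq_zero_iff] at h1)
  exact ⟨hq.1, by rw [← hell ρ hq.1.le]; exact hq.2⟩

/-- The indicator of the MCD ellipsoid is itself a minimizer, so by uniqueness it has trimmed mean
`μ₀` and covariance `Γ₀²`. Standardizing turns these into `0` and `I`, and its mass `γ` is the
remaining factor. -/
theorem standardizedMoments_of_isMCD [NeZero k] {P : Measure (Vec k)} [IsProbabilityMeasure P]
    {f : Vec k → ℝ} (hf : IsDensity P f) {γ : ℝ} (hγ : 0 < γ) {θ : Param k} (hθ : IsMCD P γ θ)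
    (hunique : MCDUnique P γ) :
    StandardizedMoments γ (standardizedDensity f θ.1 (θ.2.1 : Mat k)) θ.2.2 := by
  obtain ⟨φ, hφ, hm, hpd, hcov, hrad⟩ := hθ
  set G : Mat k := (θ.2.1 : Mat k)
  have hG : G.IsSymm := θ.2.1.2
  have hGd := hpd.det_pos
  have hGu := hGd.ne'.isUnit
  have hG' : (G⁻¹).IsSymm := by rw [Matrix.IsSymm, Matrix.transpose_nonsing_inv, hG.eq]
  obtain ⟨hρ, hmass⟩ := hrad.pos_and_mass hf hγ hG hGd hcov
  have hψ := hφ.indicator_ellipsoid hγ hpd hcov hρ.le hmass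
  obtain ⟨hT, hC⟩ := hunique _ _ hψ hφ
  rw [← hcov] at hC
  rw [hm]
  set m := trimMean P φ
  set S := ellipsoid m (G * G) θ.2.2
  have hS : MeasurableSet S := (isClosed_ellipsoid _ _ _).measurableSet
  have hpre : (fun x => act G x + m) ⁻¹' S = closedBall 0 θ.2.2 := preimage_ellipsoid hG hGu hρ.le
  have hset : ∀ {V : Type} [NormedAddCommGroup V] [NormedSpace ℝ V] (h : Vec k → V),
      ∫ y, S.indicator (1 : Vec k → ℝ) y • h (act G⁻¹ (y - m)) ∂P =
        ∫ x in closedBall 0 θ.2.2, standardizedDensity f m G x • h x := by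
    intro V _ _ h
    have h1 : ∀ y, S.indicator (1 : Vec k → ℝ) y • h (act G⁻¹ (y - m)) =
        S.indicator (fun y => h (act G⁻¹ (y - m))) y := by
      intro y
      by_cases hy : y ∈ S <;> simp [hy]
    simp only [h1]
    rw [integral_indicator hS, hf.setIntegral_eq m hGd hS, hpre]
    simp only [add_sub_cancel_right, act_inv_act hGu]
  have hψmass : ∫ y, S.indicator (1 : Vec k → ℝ) y ∂P = γ := by
    rw [integral_indicator_one hS, hmass]
  refine ⟨hρ, ?_, ?_, ?_⟩
  · rw [← hpre, ← hf.measureReal_eq m hGd hS, hmass]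
  · rw [← hset fun x => x]
    have h1 := hψ.1.integral_smul_eq hγ
    rw [hT, hψmass] at h1
    have h2 := (Matrix.toEuclideanCLM (n := Fin k) (𝕜 := ℝ) G⁻¹).integral_comp_comm
      hψ.1.integrable_smul_id
    rw [h1] at h2
    simp only [map_smul, ← act_eq_toEuclideanCLM] at h2
    simp only [act_sub, smul_sub]
    rw [integral_sub, h2, integral_smul_const, hψmass, sub_self]
    · have := (Matrix.toEuclideanCLM (n := Fin k) (𝕜 := ℝ) G⁻¹).integrable_comp
        hψ.1.integrable_smul_id
      simpa only [map_smul, ← act_eq_toEuclideanCLM] using this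
    · exact hψ.1.integrable.smul_const _
  · rw [← hset outer]
    have h1 := hψ.1.integral_smul_outer_act_eq hγ hG'
    rw [hT, hC, hψmass, ← Matrix.mul_assoc, Matrix.nonsing_inv_mul _ hGu, Matrix.one_mul,
      Matrix.mul_nonsing_inv _ hGu] at h1
    exact h1

end StandardizedDensity

/-! ### Derivative of the standardization and of truncated expectations -/

section Differentiability

attribute [-instance] instTopologicalSpaceMatrix Matrix.instUniformSpace

open Metric Filter Topology

variable {k : ℕ}

/-- The action of a matrix on `ℝ^k`, as a continuous linear map. -/
noncomputable abbrev actCLM (A : Mat k) : Vec k →L[ℝ] Vec k :=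
  Matrix.toEuclideanCLM (n := Fin k) (𝕜 := ℝ) A

/-- This reduces matrix inversion to inversion in the Banach algebra of operators, whose derivative
is known. Both inverses are zero on non-units, so no invertibility is assumed. -/
theorem actCLM_inv (G : Mat k) : actCLM G⁻¹ = Ring.inverse (actCLM G) := by
  by_cases h : IsUnit G
  · have h1 : actCLM G * actCLM G⁻¹ = 1 := by
      rw [← map_mul, Matrix.mul_nonsing_inv _ ((Matrix.isUnit_iff_isUnit_det G).1 h), map_one]
    have h2 : IsUnit (actCLM G) := h.map _
    rw [← mul_one (Ring.inverse _), ← h1, Ring.inverse_mul_cancel_left _ _ h2]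
  · have h2 : ¬ IsUnit (actCLM G) := fun h' => h ((MulEquiv.isUnit_map _).1 h')
    rw [Matrix.nonsing_inv_eq_ringInverse, Ring.inverse_non_unit _ h, Ring.inverse_non_unit _ h2]
    exact map_zero (Matrix.toEuclideanCLM (n := Fin k) (𝕜 := ℝ))

/-- The linear map that sends a parameter to the linear operator given by its matrix. -/
noncomputable def scaleOperator (k : ℕ) : Param k →L[ℝ] Vec k →L[ℝ] Vec k :=
  LinearMap.toContinuousLinearMap
    { toFun := fun θ => actCLM (θ.2.1 : Mat k)
      map_add' := fun θ θ' => by simp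
      map_smul' := fun a θ => by simp }

theorem exists_hasFDerivAt_actCLM_inv {θ₀ : Param k} (hG : IsUnit (θ₀.2.1 : Mat k).det) :
    ∃ L : Param k →L[ℝ] Vec k →L[ℝ] Vec k,
      HasFDerivAt (fun θ : Param k => actCLM (θ.2.1 : Mat k)⁻¹) L θ₀ ∧
      ∀ Δ x, L Δ x = -act (θ₀.2.1 : Mat k)⁻¹ (act (Δ.2.1 : Mat k) (act (θ₀.2.1 : Mat k)⁻¹ x)) := by
  have hu : IsUnit (actCLM (θ₀.2.1 : Mat k)) :=
    ((Matrix.isUnit_iff_isUnit_det _).2 hG).map (Matrix.toEuclideanCLM (n := Fin k) (𝕜 := ℝ))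
  obtain ⟨u, hu⟩ := hu
  have hinv : (↑u⁻¹ : Vec k →L[ℝ] Vec k) = actCLM (θ₀.2.1 : Mat k)⁻¹ := by
    rw [actCLM_inv, ← hu, Ring.inverse_unit]
  have h1 := hasFDerivAt_ringInverse (𝕜 := ℝ) u
  rw [hinv, hu] at h1
  have h2 := h1.comp θ₀ (scaleOperator k).hasFDerivAt
  refine ⟨_, h2.congr_of_eventuallyEq (Eventually.of_forall fun θ => actCLM_inv _), fun Δ x => rfl⟩

theorem exists_hasFDerivAt_standardize_linear {θ₀ : Param k} (hG : IsUnit (θ₀.2.1 : Mat k).det) :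
    ∃ M' : Param k →L[ℝ] Vec k →L[ℝ] Vec k,
      HasFDerivAt (fun θ : Param k => actCLM ((θ.2.1 : Mat k)⁻¹ * (θ₀.2.1 : Mat k))) M' θ₀ ∧
      ∀ Δ x, M' Δ x = -act ((θ₀.2.1 : Mat k)⁻¹ * (Δ.2.1 : Mat k)) x := by
  set G : Mat k := (θ₀.2.1 : Mat k)
  obtain ⟨L, hL, hLval⟩ := exists_hasFDerivAt_actCLM_inv hG
  have h := hL.clm_comp (hasFDerivAt_const (actCLM G) θ₀)
  simp only [map_mul]
  refine ⟨_, h, fun Δ x => ?_⟩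
  rw [ContinuousLinearMap.comp_zero, zero_add]
  change L Δ (act G x) = _
  rw [hLval, act_inv_act hG, act_mul]

/-- Product rule: the factor `μ₀ - m` vanishes at `θ₀`, so the variation of `G⁻¹` drops out. -/
theorem exists_hasFDerivAt_standardize_translation {θ₀ : Param k}
    (hG : IsUnit (θ₀.2.1 : Mat k).det) :
    ∃ c' : Param k →L[ℝ] Vec k,
      HasFDerivAt (fun θ : Param k => act (θ.2.1 : Mat k)⁻¹ (θ₀.1 - θ.1)) c' θ₀ ∧
      ∀ Δ, c' Δ = -act (θ₀.2.1 : Mat k)⁻¹ Δ.1 := by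
  have h1 : HasFDerivAt (fun θ : Param k => θ₀.1 - θ.1)
      (-(ContinuousLinearMap.fst ℝ (Vec k) (SymMat k × ℝ))) θ₀ :=
    (ContinuousLinearMap.fst ℝ (Vec k) (SymMat k × ℝ)).hasFDerivAt.const_sub _
  obtain ⟨L, hL, -⟩ := exists_hasFDerivAt_actCLM_inv hG
  have h2 := hL.clm_apply h1
  refine ⟨_, h2, fun Δ => ?_⟩
  rw [sub_self, map_zero, add_zero]
  change actCLM (θ₀.2.1 : Mat k)⁻¹ (-Δ.1) = -actCLM (θ₀.2.1 : Mat k)⁻¹ Δ.1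
  rw [map_neg]

theorem standardize_act_add (m : Vec k) (G : Mat k) (x : Vec k) (θ : Param k) :
    standardize (act G x + m) θ =
      actCLM ((θ.2.1 : Mat k)⁻¹ * G) x + act (θ.2.1 : Mat k)⁻¹ (m - θ.1) := by
  change _ = act ((θ.2.1 : Mat k)⁻¹ * G) x + _
  rw [standardize, act_mul, ← act_add]
  congr 1; abel

/-- The factor in the boundary integrals is the speed of the boundary of the standardized
ellipsoids. -/
theorem boundaryFactor_eq {θ₀ : Param k} {ρ : ℝ} (hθρ : θ₀.2.2 = ρ) (hρ : 0 < ρ) (h : Vec k)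
    (A : SymMat k) (s : ℝ) (ω : Vec k) :
    boundaryFactor θ₀ h A s (ρ • ω) =
      s + inner ℝ ω (act (θ₀.2.1 : Mat k)⁻¹ h) +
        ρ * inner ℝ ω (act ((θ₀.2.1 : Mat k)⁻¹ * (A : Mat k)) ω) := by
  set G : Mat k := (θ₀.2.1 : Mat k)
  have hG : G.IsSymm := θ₀.2.1.2
  have hG' : (G⁻¹).IsSymm := by rw [Matrix.IsSymm, Matrix.transpose_nonsing_inv, hG.eq]
  have hA : (A : Mat k).IsSymm := A.2
  -- `A Γ₀⁻¹` is the transpose of `Γ₀⁻¹ A`, so both have the same quadratic form and the half sum in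
  -- `boundaryFactor` collapses to one term.
  have e : inner ℝ ω (act ((A : Mat k) * G⁻¹) ω) = inner ℝ ω (act (G⁻¹ * (A : Mat k)) ω) := by
    rw [act_mul, act_mul, inner_act_right _ hA, inner_act_right _ hG', real_inner_comm]
  rw [boundaryFactor, hθρ, act_smul, act_add_left]
  simp only [inner_smul_left, inner_smul_right, inner_add_right, conj_trivial]
  change ρ * inner ℝ ω (act G⁻¹ h) / ρ + ρ * (ρ * inner ℝ ω (act (G⁻¹ * (A : Mat k)) ω) +
    ρ * inner ℝ ω (act ((A : Mat k) * G⁻¹) ω)) / (2 * ρ) + s = _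
  rw [e]
  field_simp
  ring

variable {P : Measure (Vec k)} {f : Vec k → ℝ}

/-- Integration with respect to the boundary measure. -/
theorem IsDensity.integral_nu (hf : IsDensity P f) {θ : Param k} (hρ : 0 < θ.2.2)
    (hG : 0 < (θ.2.1 : Mat k).det) {V : Type*} [NormedAddCommGroup V] [NormedSpace ℝ V]
    {F : Vec k → V} (hF : Continuous F) :
    ∫ ω, F ω ∂(nu f θ) = ∫ ω : sphere (0 : Vec k) 1, θ.2.2 ^ (k - 1) •
      (standardizedDensity f θ.1 (θ.2.1 : Mat k) (θ.2.2 • (ω : Vec k)) •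
        F (θ.2.2 • (ω : Vec k))) ∂(volume : Measure (Vec k)).toSphere := by
  have hwm := measurable_standardizedDensity hf θ.1 (θ.2.1 : Mat k)
  have hnu : nu f θ = (surfaceMeasure k θ.2.2).withDensity fun ω =>
    ENNReal.ofReal (standardizedDensity f θ.1 (θ.2.1 : Mat k) ω) := rfl
  rw [hnu, integral_withDensity_eq_integral_toReal_smul hwm.ennreal_ofReal
    (Eventually.of_forall fun _ => ENNReal.ofReal_lt_top)]
  simp only [ENNReal.toReal_ofReal (standardizedDensity_nonneg hf hG _)]
  rw [surfaceMeasure, integral_smul_measure, ENNReal.toReal_ofReal (by positivity), integral_map,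
    integral_smul]
  · exact (by fun_prop :
      Continuous fun ω : sphere (0 : Vec k) 1 => θ.2.2 • (ω : Vec k)).measurable.aemeasurable
  · exact hwm.aestronglyMeasurable.smul hF.aestronglyMeasurable

/-- The map `x ↦ Γ₀ x + μ₀` sends the sphere into the frontier of the ellipsoid: if an image point
were interior, the closed ball would be a neighborhood of one of its boundary points. -/
theorem ConditionB.continuousAt {θ : Param k} (hB : ConditionB f θ) (hρ : 0 < θ.2.2)
    (hG : IsUnit (θ.2.1 : Mat k).det) :
    ∀ x ∈ sphere (0 : Vec k) θ.2.2,
      ContinuousAt (standardizedDensity f θ.1 (θ.2.1 : Mat k)) x := by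
  obtain ⟨U, hU, hsub, hcont, -⟩ := hB
  intro x hx
  set G : Mat k := (θ.2.1 : Mat k)
  have hGs : G.IsSymm := θ.2.1.2
  set T : Vec k → Vec k := fun x => act G x + θ.1 with hT
  have hTc : Continuous T := by fun_prop
  have hpre : T ⁻¹' ellipsoid θ.1 (G * G) θ.2.2 = closedBall 0 θ.2.2 :=
    preimage_ellipsoid hGs hG hρ.le
  have hfront : T x ∈ frontier (ellipsoid θ.1 (G * G) θ.2.2) := by
    rw [(isClosed_ellipsoid _ _ _).frontier_eq]
    refine ⟨?_, fun hint => ?_⟩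
    · rw [← mem_preimage, hpre]; exact sphere_subset_closedBall hx
    · have h1 : closedBall (0 : Vec k) θ.2.2 ∈ 𝓝 x := by
        rw [← hpre]
        exact hTc.continuousAt (mem_interior_iff_mem_nhds.1 hint)
      rw [← mem_interior_iff_mem_nhds, interior_closedBall _ hρ.ne'] at h1
      rw [mem_ball_zero_iff] at h1
      rw [mem_sphere_zero_iff_norm] at hx
      linarith
  have hfc : ContinuousAt f (T x) := hcont.continuousAt (hU.mem_nhds (hsub hfront))
  have : ContinuousAt (fun x => f (T x)) x := ContinuousAt.comp (g := f) (f := T) hfc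
    hTc.continuousAt
  exact continuousAt_const.mul this

/-- The derivative of the expectation of a smooth function of the standardized observation,
truncated to the ellipsoid given by the parameter. -/
theorem exists_hasFDerivAt_integral_inside [NeZero k] [IsFiniteMeasure P] (hf : IsDensity P f)
    {θ₀ : Param k} (hρ : 0 < θ₀.2.2) (hG : 0 < (θ₀.2.1 : Mat k).det) (hB : ConditionB f θ₀)
    {V : Type*} [NormedAddCommGroup V] [NormedSpace ℝ V] [CompleteSpace V] {g : Vec k → V}
    (hg : ContDiff ℝ 1 g) :
    ∃ D : Param k →L[ℝ] V,
      HasFDerivAt (fun θ => ∫ y, inside y θ • g (standardize y θ) ∂P) D θ₀ ∧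
      ∀ (h : Vec k) (A : SymMat k) (s : ℝ), D (h, A, s) =
        (∫ x in closedBall 0 θ₀.2.2, standardizedDensity f θ₀.1 (θ₀.2.1 : Mat k) x •
          fderiv ℝ g x (-(act ((θ₀.2.1 : Mat k)⁻¹ * (A : Mat k)) x +
            act (θ₀.2.1 : Mat k)⁻¹ h))) +
          ∫ ω, boundaryFactor θ₀ h A s ω • g ω ∂(nu f θ₀) := by
  set m := θ₀.1
  set G : Mat k := (θ₀.2.1 : Mat k) with hGdef
  set ρ := θ₀.2.2 with hρdef
  have hGu := hG.ne'.isUnit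
  set M : Param k → Vec k →L[ℝ] Vec k := fun θ => actCLM ((θ.2.1 : Mat k)⁻¹ * G) with hMdef
  set c : Param k → Vec k := fun θ => act (θ.2.1 : Mat k)⁻¹ (m - θ.1) with hcdef
  set r : Param k → ℝ := fun θ => θ.2.2 with hrdef
  obtain ⟨M', hM, hM'⟩ := exists_hasFDerivAt_standardize_linear hGu
  obtain ⟨c', hc, hc'⟩ := exists_hasFDerivAt_standardize_translation hGu
  have hr : HasFDerivAt r ((ContinuousLinearMap.snd ℝ (SymMat k) ℝ).comp
      (ContinuousLinearMap.snd ℝ (Vec k) (SymMat k × ℝ))) θ₀ :=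
    ((ContinuousLinearMap.snd ℝ (SymMat k) ℝ).comp
      (ContinuousLinearMap.snd ℝ (Vec k) (SymMat k × ℝ))).hasFDerivAt
  have hM₀ : M θ₀ = 1 := by
    simp only [hMdef, ← hGdef, Matrix.nonsing_inv_mul _ hGu, map_one]
  have hc₀ : c θ₀ = 0 := by
    simp only [hcdef]
    rw [sub_self]; exact map_zero (actCLM _)
  obtain ⟨D, hD, hDval⟩ := exists_hasFDerivAt_integral_region (volume : Measure (Vec k)) hM hc hr
    hM₀ hc₀ rfl hρ (measurable_standardizedDensity hf m G)
    (integrable_standardizedDensity hf m hG) (hB.continuousAt hρ hGu) hg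
  have hfun : (fun θ => ∫ y, inside y θ • g (standardize y θ) ∂P) = fun θ =>
      ∫ x in region M c r θ, standardizedDensity f m G x • g (M θ x + c θ) := by
    ext1 θ
    rw [hf.integral_eq m hG, ← integral_indicator (isClosed_region M c r θ).measurableSet]
    congr 1 with x
    have hs := standardize_act_add m G x θ
    rw [inside, hs]
    by_cases hx : x ∈ region M c r θ
    · rw [indicator_of_mem hx, indicator_of_mem (show actCLM ((θ.2.1 : Mat k)⁻¹ * G) x +
        act (θ.2.1 : Mat k)⁻¹ (m - θ.1) ∈ {z : Vec k | ‖z‖ ≤ θ.2.2} from hx), one_smul]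
    · rw [indicator_of_notMem hx, indicator_of_notMem (show actCLM ((θ.2.1 : Mat k)⁻¹ * G) x +
        act (θ.2.1 : Mat k)⁻¹ (m - θ.1) ∉ {z : Vec k | ‖z‖ ≤ θ.2.2} from hx), zero_smul, smul_zero]
  rw [hfun]
  refine ⟨D, hD, fun h A s => ?_⟩
  rw [hDval]
  have hfin : Module.finrank ℝ (Vec k) = k := finrank_euclideanSpace_fin
  congr 1
  · congr 1 with x
    rw [hM', hc', neg_add]
  · have hbc : Continuous fun ω => boundaryFactor θ₀ h A s ω := by
      unfold boundaryFactor
      fun_prop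
    rw [hf.integral_nu hρ hG (F := fun ω => boundaryFactor θ₀ h A s ω • g ω)
      (hbc.smul hg.continuous), hfin]
    congr 1 with ω
    -- The minus signs of `M'` and `c'` cancel those in `boundarySpeed`, which leaves
    -- `boundaryFactor` at `ρ ω`.
    rw [boundarySpeed_apply, boundaryFactor_eq rfl hρ, hM', hc']
    change (s - _ - _) • _ = _
    rw [inner_neg_right, inner_neg_right]
    simp only [smul_smul]
    congr 1
    ring

end Differentiability

/-! ### The volume terms and the three derivatives -/

section Derivatives

attribute [-instance] instTopologicalSpaceMatrix Matrix.instUniformSpace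

open Metric Filter Topology

variable {k : ℕ}

/-- The bilinear map `(x, y) ↦ x y'`. -/
noncomputable def outerBilin (k : ℕ) : Vec k →L[ℝ] Vec k →L[ℝ] Mat k :=
  LinearMap.mkContinuous₂
    (LinearMap.mk₂ ℝ (fun x y : Vec k => (Matrix.vecMulVec x.ofLp y.ofLp : Mat k))
      (fun x x' y => Matrix.add_vecMulVec _ _ _) (fun a x y => Matrix.smul_vecMulVec _ _ _)
      (fun x y y' => Matrix.vecMulVec_add _ _ _) (fun a x y => Matrix.vecMulVec_smul _ _ _)) 1
    (fun x y => by
      rw [one_mul, Matrix.norm_le_iff (by positivity)]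
      intro i j
      change ‖x i * y j‖ ≤ ‖x‖ * ‖y‖
      rw [norm_mul]
      gcongr <;> exact PiLp.norm_apply_le _ _)

theorem outerBilin_apply (x y : Vec k) : outerBilin k x y = Matrix.vecMulVec x.ofLp y.ofLp := rfl

theorem outerBilin_self (x : Vec k) : outerBilin k x x = outer x := rfl

theorem outerBilin_act_left (K : Mat k) (x y : Vec k) :
    outerBilin k (act K x) y = K * outerBilin k x y := by
  simp only [outerBilin_apply, ofLp_act, Matrix.mul_vecMulVec]

theorem outerBilin_act_right (K : Mat k) (x y : Vec k) :
    outerBilin k x (act K y) = outerBilin k x y * K.transpose := by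
  simp only [outerBilin_apply, ofLp_act, Matrix.vecMulVec_mul, Matrix.vecMul_transpose]

theorem contDiff_outer : ContDiff ℝ 1 (outer : Vec k → Mat k) :=
  (outerBilin k).contDiff.clm_apply contDiff_id

theorem fderiv_outer_sub_one (x u : Vec k) :
    fderiv ℝ (fun x : Vec k => outer x - 1) x u = outerBilin k x u + outerBilin k u x := by
  have h := ((outerBilin k).hasFDerivAt (x := x)).clm_apply (hasFDerivAt_id x)
  have h' : HasFDerivAt (fun x : Vec k => outer x - 1) _ x := h.sub_const 1
  rw [h'.fderiv]
  rfl

variable {γ : ℝ} {w : Vec k → ℝ} {ρ : ℝ}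

/-- The volume term of `Λ₁`: the vanishing first moment removes `K`, and the mass `γ` multiplies
`v`. -/
theorem StandardizedMoments.integral_linear (hw : StandardizedMoments γ w ρ) (hwi : Integrable w)
    (K : Mat k) (v : Vec k) :
    ∫ x in closedBall 0 ρ, w x • (-(act K x + v)) = -(γ • v) := by
  have h1 : Integrable (fun x => w x • x) (volume.restrict (closedBall 0 ρ)) :=
    integrableOn_smul_continuous hwi continuous_id (isCompact_closedBall _ _)
  have h2 := (actCLM K).integral_comp_comm h1
  rw [hw.mean, map_zero] at h2
  have h3 : ∀ x, w x • (-(act K x + v)) = -(actCLM K (w x • x) + w x • v) := by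
    intro x
    rw [map_smul, smul_neg, smul_add]
    rfl
  simp only [h3]
  rw [integral_neg, integral_add ((actCLM K).integrable_comp h1) (hwi.restrict.smul_const v), h2,
    integral_smul_const, hw.mass, zero_add]

/-- The volume term of `Λ₂`. In direction `u` the derivative is `x u' + u x'`. For `u = -(K x + v)`,
the parts containing `v` are linear in `x` and integrate to zero, and the rest is `-(K x x' + x x'
K')`, where the second moment is `γ I`. -/
theorem StandardizedMoments.integral_quadratic (hw : StandardizedMoments γ w ρ)
    (hwi : Integrable w) (K : Mat k) (v : Vec k) :
    ∫ x in closedBall 0 ρ, w x • fderiv ℝ (fun x : Vec k => outer x - 1) x (-(act K x + v)) =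
      -(γ • (K + K.transpose)) := by
  have h1 : Integrable (fun x => w x • x) (volume.restrict (closedBall 0 ρ)) :=
    integrableOn_smul_continuous hwi continuous_id (isCompact_closedBall _ _)
  have h2 : Integrable (fun x => w x • outer x) (volume.restrict (closedBall 0 ρ)) :=
    integrableOn_smul_continuous hwi continuous_outer (isCompact_closedBall _ _)
  set Φ : Mat k →L[ℝ] Mat k := LinearMap.toContinuousLinearMap
    (LinearMap.mulLeft ℝ K + LinearMap.mulRight ℝ K.transpose)
  have hΦ : ∀ N, Φ N = K * N + N * K.transpose := fun N => rfl
  set ℓ : Vec k →L[ℝ] Mat k := outerBilin k v + (outerBilin k).flip v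
  have hℓ : ∀ x, ℓ x = outerBilin k v x + outerBilin k x v := fun x => rfl
  have h3 : ∀ x, w x • fderiv ℝ (fun x : Vec k => outer x - 1) x (-(act K x + v)) =
      -(Φ (w x • outer x) + ℓ (w x • x)) := by
    intro x
    rw [fderiv_outer_sub_one, map_smul, map_smul, hΦ, hℓ, ← smul_add, ← smul_neg]
    congr 1
    rw [map_neg, map_neg, map_add, map_add, neg_apply, add_apply, outerBilin_act_left,
      outerBilin_act_right, outerBilin_self]
    abel
  simp only [h3]
  rw [integral_neg, integral_add (Φ.integrable_comp h2) (ℓ.integrable_comp h1),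
    Φ.integral_comp_comm h2, ℓ.integral_comp_comm h1, hw.mean, hw.cov, map_zero, add_zero,
    map_smul, hΦ, Matrix.mul_one, Matrix.one_mul]

variable {P : Measure (Vec k)} {f : Vec k → ℝ} {θ₀ : Param k}

theorem exists_hasFDerivAt_Lambda1 [NeZero k] [IsProbabilityMeasure P] (hf : IsDensity P f)
    (hB : ConditionB f θ₀) (hG : 0 < (θ₀.2.1 : Mat k).det)
    (hmom : StandardizedMoments γ (standardizedDensity f θ₀.1 (θ₀.2.1 : Mat k)) θ₀.2.2) :
    ∃ D : Param k →L[ℝ] Vec k, HasFDerivAt (Lambda1 P) D θ₀ ∧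
      ∀ (h : Vec k) (A : SymMat k) (s : ℝ), D (h, A, s) =
        -(γ • act (θ₀.2.1 : Mat k)⁻¹ h) +
          ∫ ω, boundaryFactor θ₀ h A s ω • ω ∂(nu f θ₀) := by
  obtain ⟨D, hD, hval⟩ := exists_hasFDerivAt_integral_inside hf hmom.pos hG hB
    (g := fun x => x) contDiff_id
  refine ⟨D, hD, fun h A s => ?_⟩
  rw [hval]
  congr 1
  rw [← hmom.integral_linear (integrable_standardizedDensity hf _ hG)
    ((θ₀.2.1 : Mat k)⁻¹ * (A : Mat k))]
  simp only [fderiv_fun_id]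
  rfl

theorem exists_hasFDerivAt_Lambda2 [NeZero k] [IsProbabilityMeasure P] (hf : IsDensity P f)
    (hB : ConditionB f θ₀) (hG : 0 < (θ₀.2.1 : Mat k).det)
    (hmom : StandardizedMoments γ (standardizedDensity f θ₀.1 (θ₀.2.1 : Mat k)) θ₀.2.2) :
    ∃ D : Param k →L[ℝ] Mat k, HasFDerivAt (Lambda2 P) D θ₀ ∧
      ∀ (h : Vec k) (A : SymMat k) (s : ℝ), D (h, A, s) =
        -(γ • ((θ₀.2.1 : Mat k)⁻¹ * (A : Mat k) + (A : Mat k) * (θ₀.2.1 : Mat k)⁻¹)) +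
          ∫ ω, boundaryFactor θ₀ h A s ω • (outer ω - 1) ∂(nu f θ₀) := by
  obtain ⟨D, hD, hval⟩ := exists_hasFDerivAt_integral_inside hf hmom.pos hG hB
    (g := fun x => outer x - 1) (contDiff_outer.sub contDiff_const)
  refine ⟨D, hD, fun h A s => ?_⟩
  have hGs : (θ₀.2.1 : Mat k).IsSymm := θ₀.2.1.2
  have hAs : (A : Mat k).IsSymm := A.2
  rw [hval, hmom.integral_quadratic (integrable_standardizedDensity hf _ hG),
    Matrix.transpose_mul, Matrix.transpose_nonsing_inv, hGs.eq, hAs.eq]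

theorem integrable_inside [IsFiniteMeasure P] (θ : Param k) :
    Integrable (fun y => inside y θ) P := by
  have hm : Measurable fun y => inside y θ := by
    have h1 : Measurable fun y => standardize y θ := by
      have : Continuous fun y => standardize y θ := by
        unfold standardize
        fun_prop
      exact this.measurable
    exact (measurable_const.indicator (measurableSet_le measurable_norm measurable_const)).comp h1
  refine Integrable.of_bound hm.aestronglyMeasurable 1 (Eventually.of_forall fun y => ?_)
  by_cases h : standardize y θ ∈ {z : Vec k | ‖z‖ ≤ θ.2.2}
  · rw [inside, indicator_of_mem h, norm_one]
  · rw [inside, indicator_of_notMem h, norm_zero]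
    exact zero_le_one

theorem exists_hasFDerivAt_Lambda3 [NeZero k] [IsProbabilityMeasure P] (hf : IsDensity P f)
    (hB : ConditionB f θ₀) (hG : 0 < (θ₀.2.1 : Mat k).det) (hρ : 0 < θ₀.2.2) (γ : ℝ) :
    ∃ D : Param k →L[ℝ] ℝ, HasFDerivAt (Lambda3 P γ) D θ₀ ∧
      ∀ (h : Vec k) (A : SymMat k) (s : ℝ), D (h, A, s) =
        ∫ ω, boundaryFactor θ₀ h A s ω ∂(nu f θ₀) := by
  -- For a constant `g` the volume term vanishes and only the surface integral remains.
  obtain ⟨D, hD, hval⟩ := exists_hasFDerivAt_integral_inside hf hρ hG hB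
    (g := fun _ => (1 : ℝ)) contDiff_const
  have hfun : Lambda3 P γ = fun θ => (∫ y, inside y θ • (1 : ℝ) ∂P) - γ := by
    ext θ
    simp only [Lambda3, Psi3, smul_eq_mul, mul_one]
    rw [integral_sub (integrable_inside θ) (integrable_const _), integral_const, probReal_univ,
      one_smul]
  refine ⟨D, by rw [hfun]; exact hD.sub_const γ, fun h A s => ?_⟩
  rw [hval]
  simp

end Derivatives

end MCD

theorem theorem3p1 (k : ℕ) (hk : 1 ≤ k) (γ : ℝ) (hγ0 : 0 < γ) (hγ1 : γ ≤ 1)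
    (P : Measure (MCD.Vec k)) (hP : IsProbabilityMeasure P)
    (f : MCD.Vec k → ℝ) (hf : MCD.IsDensity P f)
    (μ₀ : MCD.Vec k) (Γ₀ : MCD.SymMat k) (ρ₀ : ℝ)
    (hMCD : MCD.IsMCD P γ (μ₀, Γ₀, ρ₀)) (hunique : MCD.MCDUnique P γ)
    (hB : MCD.ConditionB f (μ₀, Γ₀, ρ₀)) :
    (∃ D₁ : MCD.Param k →L[ℝ] MCD.Vec k,
      HasFDerivAt (MCD.Lambda1 P) D₁ (μ₀, Γ₀, ρ₀) ∧
      ∀ (h : MCD.Vec k) (A : MCD.SymMat k) (s : ℝ),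
        D₁ (h, A, s) =
          -(γ • MCD.act (Γ₀ : MCD.Mat k)⁻¹ h) +
            ∫ ω, MCD.boundaryFactor (μ₀, Γ₀, ρ₀) h A s ω • ω ∂(MCD.nu f (μ₀, Γ₀, ρ₀))) ∧
    (∃ D₂ : MCD.Param k →L[ℝ] MCD.Mat k,
      HasFDerivAt (MCD.Lambda2 P) D₂ (μ₀, Γ₀, ρ₀) ∧
      ∀ (h : MCD.Vec k) (A : MCD.SymMat k) (s : ℝ),
        D₂ (h, A, s) =
          -(γ • ((Γ₀ : MCD.Mat k)⁻¹ * (A : MCD.Mat k) + (A : MCD.Mat k) * (Γ₀ : MCD.Mat k)⁻¹)) +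
            ∫ ω, MCD.boundaryFactor (μ₀, Γ₀, ρ₀) h A s ω • (MCD.outer ω - 1)
              ∂(MCD.nu f (μ₀, Γ₀, ρ₀))) ∧
    (∃ D₃ : MCD.Param k →L[ℝ] ℝ,
      HasFDerivAt (MCD.Lambda3 P γ) D₃ (μ₀, Γ₀, ρ₀) ∧
      ∀ (h : MCD.Vec k) (A : MCD.SymMat k) (s : ℝ),
        D₃ (h, A, s) =
          ∫ ω, MCD.boundaryFactor (μ₀, Γ₀, ρ₀) h A s ω ∂(MCD.nu f (μ₀, Γ₀, ρ₀))) := by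
  have : NeZero k := ⟨by omega⟩
  have hG : 0 < (Γ₀ : MCD.Mat k).det := by
    obtain ⟨φ, -, -, hpd, -⟩ := hMCD
    exact hpd.det_pos
  have hmom := MCD.standardizedMoments_of_isMCD hf hγ0 hMCD hunique
  exact ⟨MCD.exists_hasFDerivAt_Lambda1 hf hB hG hmom, MCD.exists_hasFDerivAt_Lambda2 hf hB hG hmom,
    MCD.exists_hasFDerivAt_Lambda3 hf hB hG hmom.pos γ⟩
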